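/- Let $n\ge 0$, $s>0$, $\langle x\rangle=(1+|x|^2)^{1/2}$, and for $r\in\mathbb R$ let $L^2_{r}(\mathbb R^n)$ be the space of functions with $\|f\|_{0,r}^2=\int_{\mathbb R^n}\langle x\rangle^{2r}|f(x)|^2\,dx<\infty$. Put $(u,\psi)_{L^2_{-s},L^2_s}=\int u\,\overline{\psi}\,dx$ for $u\in L^2_{-s}$, $\psi\in L^2_s$. Let $H$ be a self-adjoint operator in $\mathcal H=L^2(\mathbb R^n)$ with spectral measure $E$, write $E(\lambda)=E((-\infty,\lambda))$, and let $P_{ac}(H)$ be the orthogonal projection onto the absolutely continuous subspace of $H$. Let $J\subseteq\mathbb R$ be open. Assume that the weak spectral derivative $A(\lambda)=\frac{d}{d\lambda}\big(E(\lambda)P_{ac}(H)\big)$ exists on $J$ as a bounded operator from $L^2_s$ to $L^2_{-s}$, that is, $$(A(\lambda)f,g)_{L^2_{-s},L^2_s}=\frac{d}{d\lambda}\big(E(\lambda)P_{ac}(H)f,g\big)_{\mathcal H},\qquad f,g\in L^2_s,\ \lambda\in J,$$ and that it is weakly continuous on $J$, i.e. $\lambda\mapsto(A(\lambda)f,g)_{L^2_{-s},L^2_s}$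 is continuous on $J$ for all $f,g\in L^2_s$. Let $\sigma,a$ be real-valued, $\sigma$ continuous on $J$, and let $\mathcal N\subseteq J$ be a finite set such that $a\in C^1(J\setminus\mathcal N)$, $a'>0$ on $J\setminus\mathcal N$, and $a$ is injective on $J\setminus\mathcal N$. Set $\|A(\lambda)\|_{s,-s}=\sup_{\|\psi\|_{0,s}=1}(A(\lambda)\psi,\psi)_{L^2_{-s},L^2_s}$. Then, with norms taking values in $[0,\infty]$: (i) for every $\phi\in L^2_s(\mathbb R^n)$, $$\Big\|\langle x\rangle^{-s}\sigma(H)e^{ita(H)}P_{ac}(H)E(J)\phi\Big\|_{L^2(\mathbb R_t\times\mathbb R^n_x)}=\sqrt{2\pi}\,\Big\|\frac{\sigma(\lambda)}{a'(\lambda)^{1/2}}\langle x\rangle^{-s}(A(\lambda)\phi)(x)\Big\|_{L^2(J_\lambda\times\mathbb R^n_x)};$$ (ii) for every $\phi\in L^2(\mathbb R^n)$, $$\Big\|\langle x\rangle^{-s}\sigma(H)e^{ita(H)}P_{ac}(H)E(J)\phi\Big\|_{L^2(\mathbb R_t\times\mathbb R^n_x)}\le\sqrt{2\pi}\,\sup_{\lambda\in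 J\setminus\mathcal N}\Big[\frac{|\sigma(\lambda)|}{a'(\lambda)^{1/2}}\|A(\lambda)\|_{s,-s}^{1/2}\Big]\|\phi\|_{L^2(\mathbb R^n)},$$ where the right-hand side is $0$ if $\phi=0$. If $P_{ac}(H)E(J)\phi$ belongs to the domain of $\sigma(H)$, the left-hand sides are understood literally, through the vectors $\sigma(H)e^{ita(H)}P_{ac}(H)E(J)\phi\in L^2(\mathbb R^n)$, $t\in\mathbb R$. For arbitrary $\phi$ both statements also hold with the left-hand side understood as the norm of the limit in $L^2(\mathbb R_t\times\mathbb R^n_x)$, as $k\to\infty$, of $\langle x\rangle^{-s}\sigma(H)e^{ita(H)}P_{ac}(H)E(\{\lambda\in J:|\sigma(\lambda)|\le k\})\phi$, and as $\infty$ if this limit does not exist. -/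

import Mathlib

open MeasureTheory Filter Topology
open scoped ENNReal ComplexConjugate

noncomputable section

section SpectralCalculus

variable {𝓗 : Type*} [NormedAddCommGroup 𝓗] [InnerProductSpace ℂ 𝓗] [CompleteSpace 𝓗]

/-- A projection-valued (spectral) measure on the Borel sets of `ℝ`.
The values on non-measurable sets are irrelevant. -/
structure SpectralMeasure (𝓗 : Type*) [NormedAddCommGroup 𝓗] [InnerProductSpace ℂ 𝓗]
    [CompleteSpace 𝓗] where
  /-- the projection `E(B)` attached to a Borel set `B` -/
  proj : Set ℝ → 𝓗 →L[ℂ] 𝓗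
  isStarProjection : ∀ B, MeasurableSet B → IsStarProjection (proj B)
  proj_univ : proj Set.univ = 1
  proj_inter : ∀ B C, MeasurableSet B → MeasurableSet C → proj (B ∩ C) = proj B * proj C
  hasSum : ∀ B : ℕ → Set ℝ, (∀ i, MeasurableSet (B i)) → Pairwise (Function.onFun Disjoint B) →
    ∀ φ : 𝓗, HasSum (fun i => proj (B i) φ) (proj (⋃ i, B i) φ)

namespace SpectralMeasure

variable (E : SpectralMeasure 𝓗)

theorem proj_empty_apply (φ : 𝓗) : E.proj ∅ φ = 0 := by
  have h := E.hasSum (fun _ => ∅) (fun _ => MeasurableSet.empty)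
    (fun _ _ _ => by simp [Function.onFun]) φ
  exact tendsto_nhds_unique tendsto_const_nhds h.summable.tendsto_atTop_zero

theorem inner_proj (φ : 𝓗) {B : Set ℝ} (hB : MeasurableSet B) :
    inner ℂ φ (E.proj B φ) = ((‖E.proj B φ‖ ^ 2 : ℝ) : ℂ) := by
  have h := E.isStarProjection B hB
  have h1 : E.proj B (E.proj B φ) = E.proj B φ := by
    have := h.isIdempotentElem
    exact congrArg (fun T : 𝓗 →L[ℂ] 𝓗 => T φ) this
  have h2 := (ContinuousLinearMap.isSelfAdjoint_iff_isSymmetric.mp h.isSelfAdjoint) φ (E.proj B φ)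
  simp only [ContinuousLinearMap.coe_coe] at h2
  rw [h1] at h2
  rw [← h2, inner_self_eq_norm_sq_to_K]
  norm_cast

theorem hasSum_norm_sq (φ : 𝓗) (B : ℕ → Set ℝ) (hB : ∀ i, MeasurableSet (B i))
    (hd : Pairwise (Function.onFun Disjoint B)) :
    HasSum (fun i => ‖E.proj (B i) φ‖ ^ 2) (‖E.proj (⋃ i, B i) φ‖ ^ 2) := by
  have h := (innerSL ℂ φ).hasSum (E.hasSum B hB hd φ)
  simp only [innerSL_apply_apply, E.inner_proj φ (MeasurableSet.iUnion hB)] at h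
  rw [← Complex.hasSum_ofReal]
  refine h.congr_fun ?_
  intro i
  exact (E.inner_proj φ (hB i)).symm

/-- The scalar spectral measure `μ_φ(B) = (E(B)φ, φ) = ‖E(B)φ‖²`. -/
def scalarMeasure (φ : 𝓗) : Measure ℝ :=
  Measure.ofMeasurable (fun B _ => ENNReal.ofReal (‖E.proj B φ‖ ^ 2))
    (by simp [E.proj_empty_apply])
    (by
      intro B hB hd
      have h := E.hasSum_norm_sq φ B hB hd
      rw [← h.tsum_eq, ENNReal.ofReal_tsum_of_nonneg (fun _ => by positivity) h.summable])

theorem scalarMeasure_apply (φ : 𝓗) {B : Set ℝ} (hB : MeasurableSet B) :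
    E.scalarMeasure φ B = ENNReal.ofReal (‖E.proj B φ‖ ^ 2) :=
  Measure.ofMeasurable_apply B hB

/-- `(∫ g dE) φ = ∑ c, c E(g = c) φ` for a simple function `g`. -/
def simpleApply (g : SimpleFunc ℝ ℂ) (φ : 𝓗) : 𝓗 :=
  ∑ c ∈ g.range, c • E.proj (g ⁻¹' {c}) φ

/-- `v = f(H) φ`, where `f(H) = ∫ f dE`: the vector `φ` is in the domain of `f(H)`, i.e.
`f ∈ L²(μ_φ)`, and `v` is the limit of `g(H) φ` for simple functions `g` tending to `f`
in `L²(μ_φ)`. -/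
def IsApply (f : ℝ → ℂ) (φ v : 𝓗) : Prop :=
  MemLp f 2 (E.scalarMeasure φ) ∧
    ∀ ε : ℝ, 0 < ε → ∃ g : SimpleFunc ℝ ℂ,
      eLpNorm (fun lam => f lam - g lam) 2 (E.scalarMeasure φ) ≤ ENNReal.ofReal ε ∧
        ‖v - E.simpleApply g φ‖ ≤ ε

instance (φ : 𝓗) : IsFiniteMeasure (E.scalarMeasure φ) :=
  ⟨by rw [E.scalarMeasure_apply φ MeasurableSet.univ]; exact ENNReal.ofReal_lt_top⟩

theorem inner_proj_proj (φ : 𝓗) {B C : Set ℝ} (hB : MeasurableSet B) (hC : MeasurableSet C)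
    (hBC : Disjoint B C) : inner ℂ (E.proj B φ) (E.proj C φ) = 0 := by
  have h2 := (ContinuousLinearMap.isSelfAdjoint_iff_isSymmetric.mp
    (E.isStarProjection B hB).isSelfAdjoint) φ (E.proj C φ)
  simp only [ContinuousLinearMap.coe_coe] at h2
  have h3 := congrArg (fun T : 𝓗 →L[ℂ] 𝓗 => T φ) (E.proj_inter B C hB hC)
  simp only [Set.disjoint_iff_inter_eq_empty.mp hBC, E.proj_empty_apply,
    mul_apply_eq_comp] at h3
  rw [h2, ← h3, inner_zero_right]

theorem enorm_simpleApply (g : SimpleFunc ℝ ℂ) (φ : 𝓗) :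
    ‖E.simpleApply g φ‖ₑ = eLpNorm g 2 (E.scalarMeasure φ) := by
  have h1 : ‖E.simpleApply g φ‖ ^ 2
      = ∑ c ∈ g.range, ‖c‖ ^ 2 * ‖E.proj (g ⁻¹' {c}) φ‖ ^ 2 := by
    have : ((‖E.simpleApply g φ‖ ^ 2 : ℝ) : ℂ)
        = ((∑ c ∈ g.range, ‖c‖ ^ 2 * ‖E.proj (g ⁻¹' {c}) φ‖ ^ 2 : ℝ) : ℂ) := by
      have h0 : inner ℂ (E.simpleApply g φ) (E.simpleApply g φ)
          = ((‖E.simpleApply g φ‖ : ℝ) : ℂ) ^ 2 :=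
        inner_self_eq_norm_sq_to_K (𝕜 := ℂ) (E.simpleApply g φ)
      push_cast
      rw [← h0]
      simp only [simpleApply, sum_inner, inner_sum]
      refine Finset.sum_congr rfl fun c hc => ?_
      rw [Finset.sum_eq_single c]
      · have h0 : inner ℂ (E.proj (g ⁻¹' {c}) φ) (E.proj (g ⁻¹' {c}) φ)
            = ((‖E.proj (g ⁻¹' {c}) φ‖ : ℝ) : ℂ) ^ 2 :=
          inner_self_eq_norm_sq_to_K (𝕜 := ℂ) _
        rw [inner_smul_left, inner_smul_right, h0, ← mul_assoc, mul_comm ((starRingEnd ℂ) c) c, Complex.mul_conj,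
          Complex.normSq_eq_norm_sq]
        push_cast
        ring
      · intro d _ hdc
        rw [inner_smul_left, inner_smul_right, E.inner_proj_proj φ (g.measurableSet_fiber _)
          (g.measurableSet_fiber _), mul_zero, mul_zero]
        exact Disjoint.preimage _ (by simpa using hdc)
      · intro h; exact absurd hc h
    exact_mod_cast this
  have h2 : ‖E.simpleApply g φ‖ₑ ^ 2 = (eLpNorm g 2 (E.scalarMeasure φ)) ^ 2 := by
    have h3 : (eLpNorm g 2 (E.scalarMeasure φ)) ^ 2
        = ∫⁻ x, ‖g x‖ₑ ^ 2 ∂(E.scalarMeasure φ) := by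
      rw [eLpNorm_eq_lintegral_rpow_enorm_toReal (by norm_num) (by norm_num)]
      rw [← ENNReal.rpow_natCast, ← ENNReal.rpow_mul]
      simp
    have h4 : ∫⁻ x, ‖g x‖ₑ ^ 2 ∂(E.scalarMeasure φ)
        = (g.map (fun z => ‖z‖ₑ ^ 2)).lintegral (E.scalarMeasure φ) := by
      rw [← SimpleFunc.lintegral_eq_lintegral]; rfl
    rw [h3, h4, SimpleFunc.map_lintegral, ← ofReal_norm,
      ← ENNReal.ofReal_pow (norm_nonneg _), h1,
      ENNReal.ofReal_sum_of_nonneg (fun _ _ => by positivity)]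
    refine Finset.sum_congr rfl fun c _ => ?_
    rw [E.scalarMeasure_apply φ (g.measurableSet_fiber c),
      ENNReal.ofReal_mul (by positivity), ENNReal.ofReal_pow (norm_nonneg _),
      ofReal_norm]
  exact (ENNReal.pow_right_strictMono two_ne_zero).injective h2

theorem proj_union_apply (φ : 𝓗) {B C : Set ℝ} (hB : MeasurableSet B) (hC : MeasurableSet C)
    (hBC : Disjoint B C) : E.proj (B ∪ C) φ = E.proj B φ + E.proj C φ := by
  let D : ℕ → Set ℝ := fun i => if i = 0 then B else if i = 1 then C else ∅
  have hs : HasSum (fun i => E.proj (D i) φ) (E.proj B φ + E.proj C φ) := by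
    have := hasSum_sum_of_ne_finset_zero (L := .unconditional ℕ) (s := Finset.range 2)
      (f := fun i => E.proj (D i) φ) (by
      intro i hi
      have h0 : i ≠ 0 := by rintro rfl; simp at hi
      have h1 : i ≠ 1 := by rintro rfl; simp at hi
      simp [D, h0, h1, E.proj_empty_apply])
    simpa [Finset.sum_range_succ, D] using this
  have hs' := E.hasSum D (by
      intro i
      simp only [D]
      split_ifs
      exacts [hB, hC, MeasurableSet.empty]) (by
      intro i j hij
      simp only [Function.onFun, D]
      split_ifs
      all_goals first | exact hBC | exact hBC.symm | omega | simp) φ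
  have hU : (⋃ i, D i) = B ∪ C := by
    ext x
    simp only [Set.mem_iUnion, Set.mem_union, D]
    constructor
    · rintro ⟨i, h⟩
      split_ifs at h
      · exact Or.inl h
      · exact Or.inr h
      · exact absurd h (Set.notMem_empty x)
    · rintro (h | h)
      · exact ⟨0, by simpa using h⟩
      · exact ⟨1, by simpa using h⟩
  rw [hU] at hs'
  exact hs'.unique hs

theorem simpleApply_sub (g h : SimpleFunc ℝ ℂ) (φ : 𝓗) :
    E.simpleApply (g - h) φ = E.simpleApply g φ - E.simpleApply h φ := by
  let T : Set ℝ → ℂ →L[ℝ] 𝓗 := fun B =>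
    (ContinuousLinearMap.toSpanSingleton ℂ (E.proj B φ)).restrictScalars ℝ
  have hT : ∀ g : SimpleFunc ℝ ℂ, E.simpleApply g φ = g.setToSimpleFunc T := fun g => by
    simp [simpleApply, SimpleFunc.setToSimpleFunc, T]
  have hadd : FinMeasAdditive (E.scalarMeasure φ) T := by
    intro B C hB hC _ _ hBC
    have key := E.proj_union_apply φ hB hC hBC
    ext
    simp [T, key]
  rw [hT, hT, hT, SimpleFunc.setToSimpleFunc_sub T hadd]
  · exact SimpleFunc.integrable_of_isFiniteMeasure g
  · exact SimpleFunc.integrable_of_isFiniteMeasure h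

theorem norm_simpleApply_sub_le {f : ℝ → ℂ} {φ : 𝓗} (hf : MemLp f 2 (E.scalarMeasure φ))
    {g h : SimpleFunc ℝ ℂ} {ε δ : ℝ} (hε : 0 ≤ ε) (hδ : 0 ≤ δ)
    (hg : eLpNorm (fun lam => f lam - g lam) 2 (E.scalarMeasure φ) ≤ ENNReal.ofReal ε)
    (hh : eLpNorm (fun lam => f lam - h lam) 2 (E.scalarMeasure φ) ≤ ENNReal.ofReal δ) :
    ‖E.simpleApply g φ - E.simpleApply h φ‖ ≤ ε + δ := by
  rw [← E.simpleApply_sub, ← ENNReal.ofReal_le_ofReal_iff (by positivity),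
    ofReal_norm, E.enorm_simpleApply, ENNReal.ofReal_add hε hδ]
  have hgh : (⇑(g - h) : ℝ → ℂ) = (fun lam => f lam - h lam) - fun lam => f lam - g lam := by
    ext x
    simp
  rw [hgh]
  refine (eLpNorm_sub_le ?_ ?_ (by norm_num)).trans ?_
  · exact hf.1.sub h.aestronglyMeasurable
  · exact hf.1.sub g.aestronglyMeasurable
  · rw [add_comm]; gcongr

/-- `f(H) φ` is defined for every `φ` with `f ∈ L²(μ_φ)`. -/
theorem exists_isApply {f : ℝ → ℂ} {φ : 𝓗} (hf : MemLp f 2 (E.scalarMeasure φ)) :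
    ∃ v, E.IsApply f φ v := by
  have hpos : ∀ n : ℕ, (0 : ℝ) < 1 / ((n : ℝ) + 1) := fun n => by positivity
  have H : ∀ n : ℕ, ∃ g : SimpleFunc ℝ ℂ,
      eLpNorm (fun lam => f lam - g lam) 2 (E.scalarMeasure φ)
        ≤ ENNReal.ofReal (1 / ((n : ℝ) + 1)) := by
    intro n
    obtain ⟨g, hg, -⟩ := hf.exists_simpleFunc_eLpNorm_sub_lt (by norm_num)
      (ε := ENNReal.ofReal (1 / ((n : ℝ) + 1))) (by simpa using hpos n)
    exact ⟨g, hg.le⟩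
  choose g hg using H
  have hle : ∀ n m : ℕ, ‖E.simpleApply (g n) φ - E.simpleApply (g m) φ‖
      ≤ 1 / ((n : ℝ) + 1) + 1 / ((m : ℝ) + 1) := fun n m =>
    E.norm_simpleApply_sub_le hf (hpos n).le (hpos m).le (hg n) (hg m)
  have hcau : CauchySeq fun n => E.simpleApply (g n) φ := by
    refine cauchySeq_of_le_tendsto_0 (fun n : ℕ => 2 * (1 / ((n : ℝ) + 1))) ?_ ?_
    · intro n m N hn hm
      rw [dist_eq_norm]
      have h1 := one_div_le_one_div_of_le (by positivity : (0 : ℝ) < (N : ℝ) + 1)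
        (by gcongr : (N : ℝ) + 1 ≤ (n : ℝ) + 1)
      have h2 := one_div_le_one_div_of_le (by positivity : (0 : ℝ) < (N : ℝ) + 1)
        (by gcongr : (N : ℝ) + 1 ≤ (m : ℝ) + 1)
      linarith [hle n m]
    · simpa using tendsto_one_div_add_atTop_nhds_zero_nat.const_mul (2 : ℝ)
  obtain ⟨v, hv⟩ := cauchySeq_tendsto_of_complete hcau
  refine ⟨v, hf, fun ε hε => ?_⟩
  have h1 := (Metric.tendsto_nhds.mp hv) ε hε
  have h2 := (tendsto_one_div_add_atTop_nhds_zero_nat (𝕜 := ℝ)).eventually (gt_mem_nhds hε)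
  obtain ⟨n, hn1, hn2⟩ := (h1.and h2).exists
  refine ⟨g n, (hg n).trans (ENNReal.ofReal_le_ofReal hn2.le), ?_⟩
  rw [← dist_eq_norm, dist_comm]
  exact hn1.le

/-- The vector `f(H) φ` is unique. -/
theorem IsApply.unique {f : ℝ → ℂ} {φ v w : 𝓗} (hv : E.IsApply f φ v) (hw : E.IsApply f φ w) :
    v = w := by
  rw [← sub_eq_zero, ← norm_le_zero_iff]
  refine le_of_forall_pos_le_add fun ε hε => ?_
  obtain ⟨g, hg, hgv⟩ := hv.2 (ε / 4) (by positivity)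
  obtain ⟨h, hh, hhw⟩ := hw.2 (ε / 4) (by positivity)
  have h1 := E.norm_simpleApply_sub_le hv.1 (by positivity) (by positivity) hg hh
  have h2 : v - w = (v - E.simpleApply g φ) + (E.simpleApply g φ - E.simpleApply h φ)
      - (w - E.simpleApply h φ) := by abel
  have h3 := norm_sub_le ((v - E.simpleApply g φ) + (E.simpleApply g φ - E.simpleApply h φ))
    (w - E.simpleApply h φ)
  have h4 := norm_add_le (v - E.simpleApply g φ) (E.simpleApply g φ - E.simpleApply h φ)
  rw [← h2] at h3
  linarith

open Classical in
/-- The vector `f(H) φ` for `φ` in the domain of `f(H)`, i.e. `f ∈ L²(μ_φ)`; it is set to `0`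
for the other `φ`. -/
def apply (f : ℝ → ℂ) (φ : 𝓗) : 𝓗 :=
  if hf : MemLp f 2 (E.scalarMeasure φ) then (E.exists_isApply hf).choose else 0

theorem isApply_apply {f : ℝ → ℂ} {φ : 𝓗} (hf : MemLp f 2 (E.scalarMeasure φ)) :
    E.IsApply f φ (E.apply f φ) := by
  rw [apply, dif_pos hf]
  exact (E.exists_isApply hf).choose_spec

/-- `E` is the spectral measure of `H`: `H = ∫ lam dE(lam)`, as an equality of unbounded
operators, i.e. with the domain `{φ : ∫ lam² dμ_φ(lam) < ∞}`. -/
def IsSpectralMeasureOf (H : 𝓗 →ₗ.[ℂ] 𝓗) : Prop :=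
  ∀ φ v : 𝓗, (φ, v) ∈ H.graph ↔ E.IsApply (fun lam : ℝ => (lam : ℂ)) φ v

theorem scalarMeasure_absolutelyContinuous_iff (φ : 𝓗) :
    E.scalarMeasure φ ≪ volume ↔
      ∀ B, MeasurableSet B → volume B = 0 → E.proj B φ = 0 := by
  constructor
  · intro h B hB h0
    have := h h0
    rw [E.scalarMeasure_apply φ hB, ENNReal.ofReal_eq_zero] at this
    have h2 : ‖E.proj B φ‖ ^ 2 = 0 := le_antisymm this (by positivity)
    simpa using h2
  · intro h
    refine Measure.AbsolutelyContinuous.mk fun B hB h0 => ?_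
    rw [E.scalarMeasure_apply φ hB, h B hB h0]
    simp

/-- The absolutely continuous subspace: the `φ` such that `μ_φ` is absolutely continuous with
respect to Lebesgue measure. -/
def acSubspace : Submodule ℂ 𝓗 where
  carrier := {φ | E.scalarMeasure φ ≪ volume}
  zero_mem' := by
    simp [E.scalarMeasure_absolutelyContinuous_iff]
  add_mem' := by
    intro φ ψ hφ hψ
    simp only [Set.mem_ofPred_eq, E.scalarMeasure_absolutelyContinuous_iff] at *
    intro B hB h0
    rw [map_add, hφ B hB h0, hψ B hB h0, add_zero]
  smul_mem' := by
    intro c φ hφ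
    simp only [Set.mem_ofPred_eq, E.scalarMeasure_absolutelyContinuous_iff] at *
    intro B hB h0
    rw [map_smul, hφ B hB h0, smul_zero]

theorem isClosed_acSubspace : IsClosed (E.acSubspace : Set 𝓗) := by
  have : (E.acSubspace : Set 𝓗)
      = ⋂ (B : Set ℝ) (_ : MeasurableSet B) (_ : volume B = 0), {φ | E.proj B φ = 0} := by
    ext φ
    simp only [Set.mem_iInter, Set.mem_ofPred_eq]
    exact E.scalarMeasure_absolutelyContinuous_iff φ
  rw [this]
  exact isClosed_iInter fun B => isClosed_iInter fun _ => isClosed_iInter fun _ =>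
    isClosed_eq (E.proj B).continuous continuous_const

instance : CompleteSpace E.acSubspace := E.isClosed_acSubspace.completeSpace_coe

/-- `P_ac(H)`, the orthogonal projection onto the absolutely continuous subspace. -/
def acProj : 𝓗 →L[ℂ] 𝓗 := E.acSubspace.starProjection

end SpectralMeasure
end SpectralCalculus

section WeightedSpaces

/-- `⟨x⟩ = (1 + |x|²)^{1/2}` on `ℝⁿ`. -/
def japaneseBracket {n : ℕ} (x : EuclideanSpace ℝ (Fin n)) : ℝ := Real.sqrt (1 + ‖x‖ ^ 2)

theorem one_le_japaneseBracket {n : ℕ} (x : EuclideanSpace ℝ (Fin n)) :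
    1 ≤ japaneseBracket x :=
  Real.one_le_sqrt.mpr (by nlinarith [sq_nonneg ‖x‖])

/-- The measure `⟨x⟩^{2s} dx` on `ℝⁿ`. -/
def weightedVolume (n : ℕ) (s : ℝ) : Measure (EuclideanSpace ℝ (Fin n)) :=
  volume.withDensity fun x => ENNReal.ofReal (japaneseBracket x ^ (2 * s))

/-- `L²(ℝⁿ)`, complex valued. -/
abbrev L2 (n : ℕ) : Type := Lp ℂ 2 (volume : Measure (EuclideanSpace ℝ (Fin n)))

/-- The weighted space `L²_s(ℝⁿ)`, with `‖f‖²_{0,s} = ∫ ⟨x⟩^{2s} |f(x)|² dx`. -/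
abbrev WeightedL2 (n : ℕ) (s : ℝ) : Type := Lp ℂ 2 (weightedVolume n s)

theorem volume_le_weightedVolume (n : ℕ) {s : ℝ} (hs : 0 ≤ s) :
    (volume : Measure (EuclideanSpace ℝ (Fin n))) ≤ weightedVolume n s := by
  conv_lhs => rw [← withDensity_one (μ := (volume : Measure (EuclideanSpace ℝ (Fin n))))]
  refine withDensity_mono (Eventually.of_forall fun x => ?_)
  rw [Pi.one_apply, ENNReal.one_le_ofReal]
  exact Real.one_le_rpow (one_le_japaneseBracket x) (by positivity)

/-- The inclusion `L²_s(ℝⁿ) ⊆ L²(ℝⁿ)`, for `s ≥ 0`. -/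
def WeightedL2.toL2 {n : ℕ} {s : ℝ} (hs : 0 ≤ s) (f : WeightedL2 n s) : L2 n :=
  MemLp.toLp f ((Lp.memLp f).mono_measure (volume_le_weightedVolume n hs))

/-- The pairing `(u, ψ)_{L²_{-s}, L²_s} = ∫ u(x) conj(ψ(x)) dx`. -/
def weightedPairing {n : ℕ} {s : ℝ} (u : WeightedL2 n (-s)) (ψ : WeightedL2 n s) : ℂ :=
  ∫ x : EuclideanSpace ℝ (Fin n), u x * conj (ψ x)

/-- `‖T‖_{s,-s} = sup_{‖ψ‖_{0,s} = 1} (Tψ, ψ)_{L²_{-s}, L²_s}`, for nonnegative `T`. -/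
def weightedFormNorm {n : ℕ} {s : ℝ} (T : WeightedL2 n s →L[ℂ] WeightedL2 n (-s)) : ℝ≥0∞ :=
  ⨆ (ψ : WeightedL2 n s) (_ : ‖ψ‖ = 1), ENNReal.ofReal (weightedPairing (T ψ) ψ).re

/-- The norm of `L²(I × ℝⁿ)`, as `(∫_I ∫ |F(t,x)|² dx dt)^{1/2}`. -/
def spacetimeNorm {n : ℕ} (I : Set ℝ) (F : ℝ → EuclideanSpace ℝ (Fin n) → ℂ) : ℝ≥0∞ :=
  (∫⁻ t in I, ∫⁻ x, ‖F t x‖ₑ ^ 2) ^ (1 / 2 : ℝ)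

end WeightedSpaces

section Evolution

variable {n : ℕ} (E : SpectralMeasure (L2 n)) (σ a : ℝ → ℝ)

/-- `φ` is such that `σ(H) e^{ita(H)} P_ac(H) E(J) φ` makes sense in `L²(ℝⁿ)`, i.e.
`P_ac(H) E(J) φ` is in the domain of `σ(H)`. -/
def InEvolutionDomain (J : Set ℝ) (φ : L2 n) : Prop :=
  MemLp (fun lam => (σ lam : ℂ)) 2 (E.scalarMeasure (E.acProj (E.proj J φ)))

/-- The vector `σ(H) e^{ita(H)} P_ac(H) E(J) φ`, for `φ` in the evolution domain. -/
def evolution (J : Set ℝ) (φ : L2 n) (t : ℝ) : L2 n :=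
  E.apply (fun lam => (σ lam : ℂ) * Complex.exp (Complex.I * t * a lam)) (E.acProj (E.proj J φ))

/-- The function `⟨x⟩^{-s} (σ(H) e^{ita(H)} P_ac(H) E(J) φ)(x)` of `(t, x)`, for `φ` in the
evolution domain. -/
def weightedEvolution (s : ℝ) (J : Set ℝ) (φ : L2 n) (t : ℝ) (x : EuclideanSpace ℝ (Fin n)) : ℂ :=
  (japaneseBracket x ^ (-s) : ℝ) * evolution E σ a J φ t x

/-- For arbitrary `φ ∈ L²(ℝⁿ)`, the statement that `⟨x⟩^{-s} σ(H) e^{ita(H)} P_ac(H) E(J) φ`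
is the element `U` of `L²(ℝ × ℝⁿ)`: it is the limit in `L²(ℝ × ℝⁿ)` of the functions obtained
by truncating `σ`, as usual, to the sets `{|σ| ≤ k}`, where `σ(H)` is bounded. -/
def IsWeightedEvolution (s : ℝ) (J : Set ℝ) (φ : L2 n)
    (U : ℝ × EuclideanSpace ℝ (Fin n) → ℂ) : Prop :=
  MemLp U 2 (volume : Measure (ℝ × EuclideanSpace ℝ (Fin n))) ∧
    Tendsto (fun k : ℕ => spacetimeNorm Set.univ fun t x =>
      weightedEvolution E σ a s {lam ∈ J | |σ lam| ≤ k} φ t x - U (t, x)) atTop (𝓝 0)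

/-- `‖⟨x⟩^{-s} σ(H) e^{ita(H)} P_ac(H) E(J) φ‖_{L²(ℝ × ℝⁿ)}` for arbitrary `φ ∈ L²(ℝⁿ)`; it is
`∞` if the function is not in `L²(ℝ × ℝⁿ)`. -/
def weightedEvolutionNorm (s : ℝ) (J : Set ℝ) (φ : L2 n) : ℝ≥0∞ :=
  ⨅ (U : ℝ × EuclideanSpace ℝ (Fin n) → ℂ) (_ : IsWeightedEvolution E σ a s J φ U),
    eLpNorm U 2 (volume : Measure (ℝ × EuclideanSpace ℝ (Fin n)))

end Evolution

end

/-! ### Functional calculus and the absolutely continuous projection. -/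

section SpectralCalculusLemmas

namespace SpectralMeasure

variable {𝓗 : Type*} [NormedAddCommGroup 𝓗] [InnerProductSpace ℂ 𝓗] [CompleteSpace 𝓗]
variable (E : SpectralMeasure 𝓗)

/-! The identity (i) is Plancherel's theorem in the time variable. Test the evolution of `φ ∈ L²_s`
against `⟨x⟩^{-s} e_i` for a countable orthonormal basis `e_i` of `L²`. Since `A(λ)` is the density
of `E(dλ) P_ac`, the coefficient is `∫_J σ(λ) e^{ita(λ)} h_i(λ) dλ` with `h_i(λ) = (A(λ)φ, ⟨x⟩^{-s}
e_i)`. The substitution `μ = a(λ)` makes it a Fourier integral of `σ h_i / a'`, so its square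
integrates over `t` to `2π ∫_J (σ²/a') |h_i|² dλ`. Summing over `i`, by Tonelli and Parseval, gives
(i). The carrying lemmas are `IsWeakSpectralDerivative.inner_apply`,
`IsPhase.lintegral_oscillatory_integral_sq` and `spacetimeNorm_sq_eq`.

For (ii), `A(λ)` is a nonnegative form, because `E([λ, μ)) P_ac` is an orthogonal projection. Its
Cauchy-Schwarz inequality gives `‖⟨x⟩^{-s} A(λ)φ‖² ≤ ‖A(λ)‖_{s,-s} (A(λ)φ, φ)`, and `∫_B (A(λ)φ, φ)
dλ = ‖E(B) P_ac φ‖² ≤ ‖φ‖²`. So (i) implies the estimate on `L²_s`; density of `L²_s` in `L²` and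
Fatou's lemma extend it (`enorm_mulWeight_sq_le`, `spacetimeNorm_sq_le`).

When `σ` is unbounded, the evolution is cut off to `{|σ| ≤ k}`. The squared norm of the evolution
localized to `B` is controlled by a measure of `B`; if that measure is finite on `J`, the
truncations are Cauchy and a limit exists (`exists_isWeightedEvolution`). If no limit exists, both
sides of (i) are infinite. Norms in `[0, ∞]` are compared throughout, so Plancherel is needed for
integrable functions that may fail to be square integrable. -/

theorem proj_proj {B C : Set ℝ} (hB : MeasurableSet B) (hC : MeasurableSet C) (φ : 𝓗) :
    E.proj B (E.proj C φ) = E.proj (B ∩ C) φ := by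
  rw [E.proj_inter B C hB hC]; rfl

theorem inner_proj_right {B : Set ℝ} (hB : MeasurableSet B) (φ ψ : 𝓗) :
    inner ℂ φ (E.proj B ψ) = inner ℂ (E.proj B φ) ψ :=
  ((ContinuousLinearMap.isSelfAdjoint_iff_isSymmetric.mp
    (E.isStarProjection B hB).isSelfAdjoint) φ ψ).symm

theorem scalarMeasure_proj {B : Set ℝ} (hB : MeasurableSet B) (φ : 𝓗) :
    E.scalarMeasure (E.proj B φ) = (E.scalarMeasure φ).restrict B := by
  ext C hC
  rw [Measure.restrict_apply hC, E.scalarMeasure_apply _ hC,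
    E.scalarMeasure_apply _ (hC.inter hB), E.proj_proj hC hB]

theorem proj_mem_acSubspace {B : Set ℝ} (hB : MeasurableSet B) {φ : 𝓗}
    (hφ : φ ∈ E.acSubspace) : E.proj B φ ∈ E.acSubspace := by
  change E.scalarMeasure _ ≪ volume
  rw [E.scalarMeasure_proj hB]
  exact Measure.restrict_le_self.absolutelyContinuous.trans hφ

theorem acProj_mem (φ : 𝓗) : E.acProj φ ∈ E.acSubspace :=
  Submodule.starProjection_apply_mem _ _

theorem acProj_of_mem {φ : 𝓗} (hφ : φ ∈ E.acSubspace) : E.acProj φ = φ :=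
  Submodule.starProjection_eq_self_iff.mpr hφ

theorem inner_acProj_right (φ ψ : 𝓗) : inner ℂ φ (E.acProj ψ) = inner ℂ (E.acProj φ) ψ :=
  (Submodule.inner_starProjection_left_eq_right _ φ ψ).symm

/-- `E(B)` is self-adjoint and leaves the absolutely continuous subspace invariant, hence it
commutes with the projection onto it. -/
theorem acProj_proj {B : Set ℝ} (hB : MeasurableSet B) (φ : 𝓗) :
    E.acProj (E.proj B φ) = E.proj B (E.acProj φ) := by
  refine ext_inner_left ℂ fun ψ => ?_
  have h1 : E.acProj (E.proj B (E.acProj ψ)) = E.proj B (E.acProj ψ) :=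
    E.acProj_of_mem (E.proj_mem_acSubspace hB (E.acProj_mem ψ))
  have h2 : E.acProj (E.proj B (E.acProj φ)) = E.proj B (E.acProj φ) :=
    E.acProj_of_mem (E.proj_mem_acSubspace hB (E.acProj_mem φ))
  rw [E.inner_acProj_right, E.inner_proj_right hB, ← h1, ← E.inner_acProj_right,
    ← E.inner_proj_right hB, ← E.inner_acProj_right, h2]

theorem inner_acProj_proj {B : Set ℝ} (hB : MeasurableSet B) (φ ψ : 𝓗) :
    inner ℂ φ (E.proj B (E.acProj ψ))
      = inner ℂ (E.proj B (E.acProj φ)) (E.proj B (E.acProj ψ)) := by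
  have h1 : E.proj B (E.proj B (E.acProj ψ)) = E.proj B (E.acProj ψ) := by
    rw [E.proj_proj hB hB, Set.inter_self]
  have h2 : E.acProj (E.proj B (E.acProj ψ)) = E.proj B (E.acProj ψ) :=
    E.acProj_of_mem (E.proj_mem_acSubspace hB (E.acProj_mem ψ))
  conv_lhs => rw [← h2, E.inner_acProj_right, ← h1, E.inner_proj_right hB]

theorem norm_proj_le {B : Set ℝ} (hB : MeasurableSet B) (φ : 𝓗) : ‖E.proj B φ‖ ≤ ‖φ‖ := by
  have h := E.inner_proj φ hB
  have h2 := norm_inner_le_norm (𝕜 := ℂ) φ (E.proj B φ)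
  rw [h, Complex.norm_real, Real.norm_of_nonneg (by positivity)] at h2
  by_contra! hlt
  nlinarith [norm_nonneg φ]

theorem norm_acProj_le (φ : 𝓗) : ‖E.acProj φ‖ ≤ ‖φ‖ :=
  Submodule.norm_starProjection_apply_le _ _

theorem simpleApply_zero (φ : 𝓗) : E.simpleApply 0 φ = 0 := by
  simpa using E.simpleApply_sub 0 0 φ

theorem simpleApply_add_vec (g : SimpleFunc ℝ ℂ) (φ ψ : 𝓗) :
    E.simpleApply g (φ + ψ) = E.simpleApply g φ + E.simpleApply g ψ := by
  simp [simpleApply, Finset.sum_add_distrib]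

variable {E}

/-- The definition supplies one good simple function for each `ε`; since `simpleApply` is isometric,
the error estimate passes to an arbitrary simple `g`. This allows the same `g` to serve for several
vectors at once. -/
theorem IsApply.enorm_sub_simpleApply_le {f : ℝ → ℂ} {φ v : 𝓗} (hv : E.IsApply f φ v)
    (g : SimpleFunc ℝ ℂ) :
    ‖v - E.simpleApply g φ‖ₑ ≤ eLpNorm (fun lam => f lam - g lam) 2 (E.scalarMeasure φ) := by
  refine ENNReal.le_of_forall_pos_le_add fun ε hε _ => ?_
  have hε' : (0 : ℝ) < ε / 2 := by positivity
  obtain ⟨h, hh, hvh⟩ := hv.2 (ε / 2) hε'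
  have h1 : v - E.simpleApply g φ = (v - E.simpleApply h φ) + E.simpleApply (h - g) φ := by
    rw [E.simpleApply_sub]; abel
  have h2 : (⇑(h - g) : ℝ → ℂ) = (fun lam => f lam - g lam) - fun lam => f lam - h lam := by
    ext x; simp
  have h3 : ‖v - E.simpleApply h φ‖ₑ ≤ ENNReal.ofReal (ε / 2) := by
    rw [← ofReal_norm]; exact ENNReal.ofReal_le_ofReal hvh
  calc ‖v - E.simpleApply g φ‖ₑ
      ≤ ‖v - E.simpleApply h φ‖ₑ + ‖E.simpleApply (h - g) φ‖ₑ := by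
        rw [h1]; exact enorm_add_le _ _
    _ ≤ ENNReal.ofReal (ε / 2)
        + (eLpNorm (fun lam => f lam - g lam) 2 (E.scalarMeasure φ) + ENNReal.ofReal (ε / 2)) := by
        rw [E.enorm_simpleApply, h2]
        gcongr
        refine (eLpNorm_sub_le (hv.1.1.sub g.aestronglyMeasurable)
          (hv.1.1.sub h.aestronglyMeasurable) (by norm_num)).trans ?_
        exact add_le_add le_rfl hh
    _ = eLpNorm (fun lam => f lam - g lam) 2 (E.scalarMeasure φ) + ε := by
        rw [add_left_comm, ← ENNReal.ofReal_add hε'.le hε'.le, add_halves, ENNReal.ofReal_coe_nnreal]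

theorem IsApply.enorm_le {f : ℝ → ℂ} {φ v : 𝓗} (hv : E.IsApply f φ v) :
    ‖v‖ₑ ≤ eLpNorm f 2 (E.scalarMeasure φ) := by
  simpa [E.simpleApply_zero] using hv.enorm_sub_simpleApply_le 0

variable (E)

/-- No domain condition is needed: outside the domain `E.apply f φ` has the default value `0`. -/
theorem enorm_apply_le (f : ℝ → ℂ) (φ : 𝓗) :
    ‖E.apply f φ‖ₑ ≤ eLpNorm f 2 (E.scalarMeasure φ) := by
  by_cases hf : MemLp f 2 (E.scalarMeasure φ)
  · exact (E.isApply_apply hf).enorm_le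
  · simp [apply, hf]

theorem exists_simpleFunc_eLpNorm_sub_le {f : ℝ → ℂ} {μ : Measure ℝ} (hf : MemLp f 2 μ) {ε : ℝ}
    (hε : 0 < ε) : ∃ g : SimpleFunc ℝ ℂ,
      eLpNorm (fun lam => f lam - g lam) 2 μ ≤ ENNReal.ofReal ε := by
  obtain ⟨g, hg, -⟩ := hf.exists_simpleFunc_eLpNorm_sub_lt (by norm_num)
    (ε := ENNReal.ofReal ε) (by simpa using hε)
  exact ⟨g, hg.le⟩

theorem isApply_sub {f g : ℝ → ℂ} {φ v w : 𝓗} (hv : E.IsApply f φ v) (hw : E.IsApply g φ w) :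
    E.IsApply (f - g) φ (v - w) := by
  refine ⟨hv.1.sub hw.1, fun ε hε => ?_⟩
  obtain ⟨p, hp, hvp⟩ := hv.2 (ε / 2) (by positivity)
  obtain ⟨q, hq, hwq⟩ := hw.2 (ε / 2) (by positivity)
  refine ⟨p - q, ?_, ?_⟩
  · have : (fun lam => (f - g) lam - (p - q) lam)
        = (fun lam => f lam - p lam) - fun lam => g lam - q lam := by
      ext x; simp; ring
    rw [this]
    refine (eLpNorm_sub_le (hv.1.1.sub p.aestronglyMeasurable)
      (hw.1.1.sub q.aestronglyMeasurable) (by norm_num)).trans ?_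
    rw [← add_halves ε, ENNReal.ofReal_add (by positivity) (by positivity)]
    exact add_le_add hp hq
  · rw [E.simpleApply_sub]
    have : v - w - (E.simpleApply p φ - E.simpleApply q φ)
        = (v - E.simpleApply p φ) - (w - E.simpleApply q φ) := by abel
    rw [this]
    linarith [norm_sub_le (v - E.simpleApply p φ) (w - E.simpleApply q φ)]

theorem apply_sub {f g : ℝ → ℂ} {φ : 𝓗} (hf : MemLp f 2 (E.scalarMeasure φ))
    (hg : MemLp g 2 (E.scalarMeasure φ)) :
    E.apply (f - g) φ = E.apply f φ - E.apply g φ :=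
  (E.isApply_apply (hf.sub hg)).unique _
    (E.isApply_sub (E.isApply_apply hf) (E.isApply_apply hg))

theorem memLp_add_measure {f : ℝ → ℂ} {μ ν : Measure ℝ} (hμ : MemLp f 2 μ) (hν : MemLp f 2 ν) :
    MemLp f 2 (μ + ν) := by
  refine ⟨hμ.1.add_measure hν.1, ?_⟩
  have h := fun (ρ : Measure ℝ) => eLpNorm_lt_top_iff_lintegral_rpow_enorm_lt_top (f := f) (μ := ρ)
    two_ne_zero ENNReal.ofNat_ne_top
  rw [h, lintegral_add_measure]
  exact ENNReal.add_lt_top.mpr ⟨(h μ).mp hμ.2, (h ν).mp hν.2⟩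

theorem apply_add_vec {f : ℝ → ℂ} {φ ψ : 𝓗} (hφ : MemLp f 2 (E.scalarMeasure φ))
    (hψ : MemLp f 2 (E.scalarMeasure ψ)) (hφψ : MemLp f 2 (E.scalarMeasure (φ + ψ))) :
    E.apply f (φ + ψ) = E.apply f φ + E.apply f ψ := by
  -- A simple function close to `f` for the sum of the three scalar measures is close for each of
  -- them, and `simpleApply` is additive in the vector.
  have hmem : MemLp f 2 (E.scalarMeasure φ + E.scalarMeasure ψ + E.scalarMeasure (φ + ψ)) :=
    memLp_add_measure (memLp_add_measure hφ hψ) hφψ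
  rw [← sub_eq_zero, ← norm_le_zero_iff]
  refine le_of_forall_pos_le_add fun ε hε => ?_
  obtain ⟨g, hg⟩ := exists_simpleFunc_eLpNorm_sub_le hmem (ε := ε / 3) (by positivity)
  have key : ∀ χ : 𝓗, MemLp f 2 (E.scalarMeasure χ) → E.scalarMeasure χ
      ≤ E.scalarMeasure φ + E.scalarMeasure ψ + E.scalarMeasure (φ + ψ) →
      ‖E.apply f χ - E.simpleApply g χ‖ ≤ ε / 3 := by
    intro χ hχ hle
    have := ((E.isApply_apply hχ).enorm_sub_simpleApply_le g).trans
      ((eLpNorm_mono_measure _ hle).trans hg)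
    rwa [← ofReal_norm, ENNReal.ofReal_le_ofReal_iff (by positivity)] at this
  have h1 := key φ hφ ((Measure.le_add_right le_rfl).trans (Measure.le_add_right le_rfl))
  have h2 := key ψ hψ ((Measure.le_add_left le_rfl).trans (Measure.le_add_right le_rfl))
  have h3 := key (φ + ψ) hφψ (Measure.le_add_left le_rfl)
  have h4 : E.apply f (φ + ψ) - (E.apply f φ + E.apply f ψ)
      = (E.apply f (φ + ψ) - E.simpleApply g (φ + ψ)) - (E.apply f φ - E.simpleApply g φ)
        - (E.apply f ψ - E.simpleApply g ψ) := by
    rw [E.simpleApply_add_vec]; abel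
  rw [h4]
  have h5 := norm_sub_le ((E.apply f (φ + ψ) - E.simpleApply g (φ + ψ))
    - (E.apply f φ - E.simpleApply g φ)) (E.apply f ψ - E.simpleApply g ψ)
  have h6 := norm_sub_le (E.apply f (φ + ψ) - E.simpleApply g (φ + ψ))
    (E.apply f φ - E.simpleApply g φ)
  linarith

/-- `f(H) E(C) φ = f(H) E(B) φ + f(H) E(C \ B) φ` for `B ⊆ C`. -/
theorem apply_proj_diff {f : ℝ → ℂ} {φ : 𝓗} {B C : Set ℝ} (hB : MeasurableSet B)
    (hC : MeasurableSet C) (hBC : B ⊆ C) (hf : MemLp f 2 (E.scalarMeasure (E.proj C φ))) :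
    E.apply f (E.proj C φ) = E.apply f (E.proj B φ) + E.apply f (E.proj (C \ B) φ) := by
  have h : E.proj C φ = E.proj B φ + E.proj (C \ B) φ := by
    rw [← E.proj_union_apply φ hB (hC.diff hB) Set.disjoint_sdiff_right,
      Set.union_sdiff_cancel hBC]
  have hB' : MemLp f 2 (E.scalarMeasure (E.proj B φ)) := by
    rw [E.scalarMeasure_proj hC] at hf
    rw [E.scalarMeasure_proj hB]
    exact hf.mono_measure (Measure.restrict_mono hBC le_rfl)
  have hD' : MemLp f 2 (E.scalarMeasure (E.proj (C \ B) φ)) := by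
    rw [E.scalarMeasure_proj hC] at hf
    rw [E.scalarMeasure_proj (hC.diff hB)]
    exact hf.mono_measure (Measure.restrict_mono Set.sdiff_subset le_rfl)
  conv_lhs => rw [h]
  exact E.apply_add_vec hB' hD' (h ▸ hf)

end SpectralMeasure
end SpectralCalculusLemmas

/-! ### Plancherel's theorem with norms in `[0, ∞]`. -/

section Plancherel

open scoped FourierTransform SchwartzMap

theorem ae_eq_of_integral_schwartz_mul_eq {f g : ℝ → ℂ} (hf : LocallyIntegrable f)
    (hg : LocallyIntegrable g) (h : ∀ ψ : 𝓢(ℝ, ℂ), ∫ x, ψ x • f x = ∫ x, ψ x • g x) :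
    f =ᵐ[volume] g := by
  refine ae_eq_of_integral_contDiff_smul_eq hf hg fun ψ hψ hψc => ?_
  have h1 : HasCompactSupport (fun x => (ψ x : ℂ)) := hψc.comp_left (g := fun x : ℝ => (x : ℂ)) (by simp)
  have h2 : ContDiff ℝ (⊤ : ℕ∞) (fun x => (ψ x : ℂ)) := Complex.ofRealCLM.contDiff.comp hψ
  exact h (h1.toSchwartzMap h2)

theorem integral_schwartz_smul_fourier {g : ℝ → ℂ} (hg : Integrable g) (ψ : 𝓢(ℝ, ℂ)) :
    ∫ x, ψ x • 𝓕 g x = ∫ x, (𝓕 ψ) x • g x := by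
  have h := VectorFourier.integral_fourierIntegral_smul_eq_flip (L := innerₗ ℝ)
    (e := Real.fourierChar) (μ := volume) (ν := volume) Real.continuous_fourierChar
    continuous_inner hg ψ.integrable
  rw [SchwartzMap.fourier_coe]
  simp only [smul_eq_mul, flip_innerₗ] at h ⊢
  rw [show (∫ x, ψ x * 𝓕 g x) = ∫ x, 𝓕 g x * ψ x from by simp_rw [mul_comm]]
  rw [show (∫ x, 𝓕 (⇑ψ) x * g x) = ∫ x, g x * 𝓕 (⇑ψ) x from by simp_rw [mul_comm]]
  exact h

theorem continuous_fourier_of_integrable {g : ℝ → ℂ} (hg : Integrable g) : Continuous (𝓕 g) :=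
  VectorFourier.fourierIntegral_continuous Real.continuous_fourierChar
    (L := innerₗ ℝ) continuous_inner hg

/-- Plancherel's theorem for an integrable function, with norms in `[0, ∞]`. -/
theorem eLpNorm_fourier_eq {g : ℝ → ℂ} (hg : Integrable g) :
    eLpNorm (𝓕 g) 2 volume = eLpNorm g 2 volume := by
  have hc := continuous_fourier_of_integrable hg
  by_cases h2 : MemLp g 2 volume
  -- The `L²` Fourier transform and the Fourier integral define the same tempered distribution,
  -- hence agree almost everywhere.
  · have key : ((𝓕 (h2.toLp g) : Lp ℂ 2 (volume : Measure ℝ)) : ℝ → ℂ) =ᵐ[volume] 𝓕 g := by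
      refine ae_eq_of_integral_schwartz_mul_eq ((Lp.memLp _).locallyIntegrable (by norm_num))
        hc.locallyIntegrable fun ψ => ?_
      rw [← Lp.toTemperedDistribution_apply, ← Lp.fourier_toTemperedDistribution_eq,
        TemperedDistribution.fourier_apply, Lp.toTemperedDistribution_apply,
        integral_schwartz_smul_fourier hg]
      refine integral_congr_ae ?_
      filter_upwards [h2.coeFn_toLp] with x hx
      rw [hx]
    rw [← eLpNorm_congr_ae key, ← Lp.enorm_def, ← ofReal_norm, Lp.norm_fourier_eq, ofReal_norm,
      Lp.enorm_toLp]
  -- Here `g` is not in `L²`. If `𝓕 g` were, its inverse `L²` transform would equal `g` almost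
  -- everywhere, a contradiction; so both norms are infinite.
  by_cases h3 : MemLp (𝓕 g) 2 volume
  · have key : ((𝓕⁻ (h3.toLp (𝓕 g)) : Lp ℂ 2 (volume : Measure ℝ)) : ℝ → ℂ) =ᵐ[volume] g := by
      refine ae_eq_of_integral_schwartz_mul_eq ((Lp.memLp _).locallyIntegrable (by norm_num))
        hg.locallyIntegrable fun ψ => ?_
      obtain ⟨χ, rfl⟩ : ∃ χ : 𝓢(ℝ, ℂ), ψ = 𝓕 χ := ⟨𝓕⁻ ψ, by simp⟩
      rw [← Lp.toTemperedDistribution_apply, ← TemperedDistribution.fourier_apply,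
        Lp.fourier_toTemperedDistribution_eq, FourierTransform.fourier_fourierInv_eq,
        Lp.toTemperedDistribution_apply, ← integral_schwartz_smul_fourier hg]
      refine integral_congr_ae ?_
      filter_upwards [h3.coeFn_toLp] with x hx
      rw [hx]
    exact absurd ((memLp_congr_ae key).mp (Lp.memLp _)) h2
  · have h4 : eLpNorm g 2 volume = ∞ := by
      by_contra h; exact h2 ⟨hg.1, lt_top_iff_ne_top.mpr h⟩
    have h5 : eLpNorm (𝓕 g) 2 volume = ∞ := by
      by_contra h; exact h3 ⟨hc.aestronglyMeasurable, lt_top_iff_ne_top.mpr h⟩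
    rw [h4, h5]

theorem lintegral_enorm_fourier_sq {g : ℝ → ℂ} (hg : Integrable g) :
    ∫⁻ t, ‖𝓕 g t‖ₑ ^ 2 = ∫⁻ x, ‖g x‖ₑ ^ 2 := by
  have h := eLpNorm_fourier_eq hg
  rw [eLpNorm_eq_lintegral_rpow_enorm_toReal (by norm_num) (by norm_num),
    eLpNorm_eq_lintegral_rpow_enorm_toReal (by norm_num) (by norm_num)] at h
  simpa using (ENNReal.rpow_left_injective (x := 1 / 2) (by norm_num)) (by simpa using h)

/-- The scaling `t ↦ -2πt` turns `e^{itx}` into the kernel `e^{-2πitx}` of `𝓕`; its Jacobian is the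
factor `2π`. -/
theorem lintegral_enorm_exp_integral_sq {g : ℝ → ℂ} (hg : Integrable g) :
    ∫⁻ t : ℝ, ‖∫ x : ℝ, Complex.exp (Complex.I * t * x) * g x‖ₑ ^ 2
      = ENNReal.ofReal (2 * Real.pi) * ∫⁻ x, ‖g x‖ₑ ^ 2 := by
  rw [← lintegral_enorm_fourier_sq hg]
  have hpi : (0 : ℝ) < 2 * Real.pi := by positivity
  have h := lintegral_image_eq_lintegral_abs_deriv_mul (s := Set.univ)
    (f := fun t : ℝ => -(2 * Real.pi) * t) (f' := fun _ => -(2 * Real.pi)) MeasurableSet.univ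
    (fun x _ => by
      simpa using! ((hasDerivAt_id x).const_mul (-(2 * Real.pi))).hasDerivWithinAt (s := Set.univ))
    (fun x _ y _ hxy => by
      have : -(2 * Real.pi) ≠ 0 := by simp [Real.pi_ne_zero]
      exact mul_left_cancel₀ this hxy)
    (fun t : ℝ => ‖∫ x : ℝ, Complex.exp (Complex.I * t * x) * g x‖ₑ ^ 2)
  have hs : (fun t : ℝ => -(2 * Real.pi) * t) '' Set.univ = Set.univ := by
    rw [Set.image_univ]
    exact (mul_left_surjective₀ (neg_ne_zero.mpr hpi.ne')).range_eq
  rw [hs] at h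
  simp only [Measure.restrict_univ, abs_neg, abs_of_pos hpi] at h
  rw [h, lintegral_const_mul']
  · congr 1
    refine lintegral_congr fun t => ?_
    rw [Real.fourier_eq']
    congr 3
    ext x
    rw [smul_eq_mul]
    congr 2
    simp
    ring
  · exact ENNReal.ofReal_ne_top

end Plancherel

/-! ### Joint measurability and the space-time norm. -/

section JointVersion

/-- A continuous curve in `L²(ν)` is represented by a jointly measurable function. -/
theorem exists_stronglyMeasurable_joint_version {X : Type*} [MeasurableSpace X] {ν : Measure X}
    {w : ℝ → Lp ℂ 2 ν} (hw : Continuous w) :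
    ∃ W : ℝ × X → ℂ, StronglyMeasurable W ∧ ∀ t, (fun x => W (t, x)) =ᵐ[ν] w t := by
  have hpos : ∀ k : ℕ, (0 : ℝ) < (1 / 2) ^ k / 4 := fun k => by positivity
  have hex : ∀ (k : ℕ) (t : ℝ), ∃ i : ℕ,
      ‖w t - w (TopologicalSpace.denseSeq ℝ i)‖ < (1 / 2) ^ k / 4 := by
    intro k t
    have ho : IsOpen {r : ℝ | ‖w t - w r‖ < (1 / 2) ^ k / 4} :=
      isOpen_lt (by fun_prop) continuous_const
    obtain ⟨i, hi⟩ := (TopologicalSpace.denseRange_denseSeq ℝ).exists_mem_open ho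
      ⟨t, by simp⟩
    exact ⟨i, hi⟩
  classical
  -- The curve is replaced by countably-valued approximations: `ι k t` is the first index in a dense
  -- sequence at which `w` is within `2^{-k}/4` of `w t`. Two approximations of order at least `N`
  -- then differ by less than `2^{-N}`, which is summable, so they converge almost everywhere in `x`
  -- for every `t`.
  let ι : ℕ → ℝ → ℕ := fun k t => Nat.find (hex k t)
  have hι : ∀ k, Measurable (ι k) := fun k =>
    measurable_find _ fun i => (isOpen_lt (by fun_prop) continuous_const).measurableSet
  have hι' : ∀ k t, ‖w t - w (TopologicalSpace.denseSeq ℝ (ι k t))‖ < (1 / 2) ^ k / 4 :=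
    fun k t => Nat.find_spec (hex k t)
  let V : ℕ → ℝ × X → ℂ := fun k p => w (TopologicalSpace.denseSeq ℝ (ι k p.1)) p.2
  have hV : ∀ k, StronglyMeasurable (V k) := by
    intro k
    have h1 : Measurable (fun q : ℕ × X => w (TopologicalSpace.denseSeq ℝ q.1) q.2) :=
      measurable_from_prod_countable_right fun i =>
        (Lp.stronglyMeasurable (w (TopologicalSpace.denseSeq ℝ i))).measurable
    exact (h1.comp (((hι k).comp measurable_fst).prodMk measurable_snd)).stronglyMeasurable
  refine ⟨fun p => limUnder atTop fun k => V k p, StronglyMeasurable.limUnder hV, fun t => ?_⟩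
  let v : ℕ → Lp ℂ 2 ν := fun k => w (TopologicalSpace.denseSeq ℝ (ι k t))
  have hcau : ∀ N n m : ℕ, N ≤ n → N ≤ m →
      eLpNorm ((v n : X → ℂ) - (v m : X → ℂ)) 2 ν < ENNReal.ofReal ((1 / 2) ^ N) := by
    intro N n m hn hm
    rw [← eLpNorm_congr_ae (Lp.coeFn_sub _ _), ← Lp.enorm_def, ← ofReal_norm]
    refine (ENNReal.ofReal_lt_ofReal_iff (by positivity)).mpr ?_
    have h1 := hι' n t
    have h2 := hι' m t
    have h3 : (1 / 2 : ℝ) ^ n ≤ (1 / 2) ^ N := pow_le_pow_of_le_one (by norm_num) (by norm_num) hn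
    have h4 : (1 / 2 : ℝ) ^ m ≤ (1 / 2) ^ N := pow_le_pow_of_le_one (by norm_num) (by norm_num) hm
    have h5 : v n - v m = (w t - v m) - (w t - v n) := by abel
    have h6 := norm_sub_le (w t - v m) (w t - v n)
    rw [← h5] at h6
    have h7 : (0 : ℝ) < (1 / 2) ^ N := by positivity
    linarith
  have hsum : ∑' N : ℕ, ENNReal.ofReal ((1 / 2) ^ N) ≠ ∞ := by
    rw [← ENNReal.ofReal_tsum_of_nonneg (fun _ => by positivity) summable_geometric_two]
    exact ENNReal.ofReal_ne_top
  have hlim := Lp.ae_tendsto_of_cauchy_eLpNorm (p := 2) (f := fun k => (v k : X → ℂ))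
    (fun k => Lp.aestronglyMeasurable _) (by norm_num) hsum hcau
  have hlim' : ∀ᵐ x ∂ν, Tendsto (fun k => (v k : X → ℂ) x) atTop
      (𝓝 (limUnder atTop fun k => V k (t, x))) := by
    filter_upwards [hlim] with x hx
    exact tendsto_nhds_limUnder hx
  have h1 := Lp.cauchy_tendsto_of_tendsto (p := 2) (f := fun k => (v k : X → ℂ))
    (fun k => Lp.aestronglyMeasurable _) (fun x => limUnder atTop fun k => V k (t, x)) hsum hcau hlim'
  have hWm : AEStronglyMeasurable (fun x => limUnder atTop fun k => V k (t, x)) ν :=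
    aestronglyMeasurable_of_tendsto_ae atTop (fun k => Lp.aestronglyMeasurable (v k)) hlim'
  have h2 : Tendsto (fun k => eLpNorm ((v k : X → ℂ) - (w t : X → ℂ)) 2 ν) atTop (𝓝 0) := by
    have h3 : Tendsto (fun k => ‖v k - w t‖ₑ) atTop (𝓝 0) := by
      have h4 : Tendsto (fun k => ‖v k - w t‖) atTop (𝓝 0) := by
        refine squeeze_zero (fun _ => norm_nonneg _) (g := fun k => (1 / 2) ^ k / 4) (fun k => ?_) ?_
        · rw [norm_sub_rev]; exact (hι' k t).le
        · simpa using (tendsto_pow_atTop_nhds_zero_of_lt_one (r := (1 / 2 : ℝ)) (by norm_num)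
            (by norm_num)).div_const 4
      simpa [ofReal_norm] using ENNReal.tendsto_ofReal h4
    refine h3.congr fun k => ?_
    rw [← eLpNorm_congr_ae (Lp.coeFn_sub _ _), ← Lp.enorm_def]
  -- The pointwise limit and `w t` are both limits in measure of the same sequence.
  exact tendstoInMeasure_ae_unique
    (tendstoInMeasure_of_tendsto_eLpNorm (by norm_num) (fun k => Lp.aestronglyMeasurable _) hWm h1)
    (tendstoInMeasure_of_tendsto_eLpNorm (by norm_num) (fun k => Lp.aestronglyMeasurable _)
      (Lp.aestronglyMeasurable _) h2)

variable {n : ℕ}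

/-- Tonelli's theorem requires joint measurability; the jointly measurable versions are built for
this passage. -/
theorem eLpNorm_eq_spacetimeNorm {U : ℝ × EuclideanSpace ℝ (Fin n) → ℂ}
    (hU : AEStronglyMeasurable U volume) :
    eLpNorm U 2 volume = spacetimeNorm Set.univ fun t x => U (t, x) := by
  rw [spacetimeNorm, eLpNorm_eq_lintegral_rpow_enorm_toReal (by norm_num) (by norm_num)]
  simp only [ENNReal.toReal_ofNat, ENNReal.rpow_ofNat, Measure.restrict_univ]
  rw [Measure.volume_eq_prod, lintegral_prod]
  exact (hU.enorm.pow_const 2)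

/-- The comparison is slice by slice, because representatives of `L²` classes are chosen separately
for each `t` and need not be jointly measurable. -/
theorem spacetimeNorm_congr {I : Set ℝ} {F G : ℝ → EuclideanSpace ℝ (Fin n) → ℂ}
    (h : ∀ t, F t =ᵐ[volume] G t) : spacetimeNorm I F = spacetimeNorm I G := by
  rw [spacetimeNorm, spacetimeNorm]
  congr 1
  refine lintegral_congr fun t => lintegral_congr_ae ?_
  filter_upwards [h t] with x hx
  rw [hx]

theorem spacetimeNorm_sq (I : Set ℝ) (F : ℝ → EuclideanSpace ℝ (Fin n) → ℂ) :
    spacetimeNorm I F ^ 2 = ∫⁻ t in I, ∫⁻ x, ‖F t x‖ₑ ^ 2 := by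
  rw [spacetimeNorm, ← ENNReal.rpow_natCast, ← ENNReal.rpow_mul]
  simp

end JointVersion

/-! ### Weighted spaces, duality and Parseval's identity. -/

section WeightedSpaceLemmas

variable {n : ℕ}

theorem japaneseBracket_pos (x : EuclideanSpace ℝ (Fin n)) : 0 < japaneseBracket x :=
  zero_lt_one.trans_le (one_le_japaneseBracket x)

theorem continuous_japaneseBracket_rpow (r : ℝ) :
    Continuous fun x : EuclideanSpace ℝ (Fin n) => japaneseBracket x ^ r := by
  have : Continuous fun x : EuclideanSpace ℝ (Fin n) => japaneseBracket x := by
    unfold japaneseBracket; fun_prop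
  exact this.rpow_const fun x => Or.inl (japaneseBracket_pos x).ne'

theorem weightedVolume_absolutelyContinuous (r : ℝ) : weightedVolume n r ≪ volume :=
  withDensity_absolutelyContinuous _ _

theorem absolutelyContinuous_weightedVolume (r : ℝ) :
    (volume : Measure (EuclideanSpace ℝ (Fin n))) ≪ weightedVolume n r := by
  refine withDensity_absolutelyContinuous' ?_ (Eventually.of_forall fun x => ?_)
  · exact (continuous_japaneseBracket_rpow _).measurable.ennreal_ofReal.aemeasurable
  · simpa using Real.rpow_pos_of_pos (japaneseBracket_pos x) _

theorem ae_weightedVolume_iff (r : ℝ) {p : EuclideanSpace ℝ (Fin n) → Prop} :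
    (∀ᵐ x ∂(weightedVolume n r), p x) ↔ ∀ᵐ x, p x :=
  ⟨fun h => (absolutelyContinuous_weightedVolume r).ae_le h,
    fun h => (weightedVolume_absolutelyContinuous r).ae_le h⟩

theorem eLpNorm_weightedVolume (r : ℝ) (f : EuclideanSpace ℝ (Fin n) → ℂ) :
    eLpNorm f 2 (weightedVolume n r)
      = eLpNorm (fun x => ((japaneseBracket x ^ r : ℝ) : ℂ) * f x) 2 volume := by
  rw [eLpNorm_eq_lintegral_rpow_enorm_toReal (by norm_num) (by norm_num),
    eLpNorm_eq_lintegral_rpow_enorm_toReal (by norm_num) (by norm_num)]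
  congr 1
  rw [weightedVolume, lintegral_withDensity_eq_lintegral_mul_non_measurable]
  · refine lintegral_congr fun x => ?_
    have hx := japaneseBracket_pos x
    rw [Pi.mul_apply, enorm_mul, ENNReal.mul_rpow_of_nonneg _ _ (by norm_num)]
    congr 1
    rw [← ofReal_norm, Complex.norm_real, Real.norm_of_nonneg (by positivity),
      ENNReal.ofReal_rpow_of_nonneg (by positivity) (by norm_num), ← Real.rpow_mul hx.le]
    simp [mul_comm]
  · exact (continuous_japaneseBracket_rpow _).measurable.ennreal_ofReal
  · exact Eventually.of_forall fun x => ENNReal.ofReal_lt_top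

theorem aestronglyMeasurable_japaneseBracket_mul (r : ℝ) {f : EuclideanSpace ℝ (Fin n) → ℂ}
    (hf : AEStronglyMeasurable f volume) :
    AEStronglyMeasurable (fun x => ((japaneseBracket x ^ r : ℝ) : ℂ) * f x) volume :=
  (Complex.continuous_ofReal.comp (continuous_japaneseBracket_rpow r)).aestronglyMeasurable.mul hf

theorem memLp_weightedVolume_iff (r : ℝ) {f : EuclideanSpace ℝ (Fin n) → ℂ}
    (hf : AEStronglyMeasurable f volume) : MemLp f 2 (weightedVolume n r) ↔
      MemLp (fun x => ((japaneseBracket x ^ r : ℝ) : ℂ) * f x) 2 volume := by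
  rw [MemLp, MemLp, eLpNorm_weightedVolume]
  exact and_congr_left fun _ => ⟨fun _ => aestronglyMeasurable_japaneseBracket_mul r hf,
    fun _ => hf.mono_ac (weightedVolume_absolutelyContinuous r)⟩

theorem japaneseBracket_mul_mul_neg (r : ℝ) (x : EuclideanSpace ℝ (Fin n)) (z : ℂ) :
    ((japaneseBracket x ^ r : ℝ) : ℂ) * (((japaneseBracket x ^ (-r) : ℝ) : ℂ) * z) = z := by
  rw [← mul_assoc, ← Complex.ofReal_mul, ← Real.rpow_add (japaneseBracket_pos x)]
  simp

/-- The isometry `v ↦ ⟨x⟩^{-s} v` of `L²` onto `L²_s`. -/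
noncomputable def weightedOfL2 (s : ℝ) (v : L2 n) : WeightedL2 n s :=
  MemLp.toLp (fun x => ((japaneseBracket x ^ (-s) : ℝ) : ℂ) * v x) (by
    rw [memLp_weightedVolume_iff s
      (aestronglyMeasurable_japaneseBracket_mul _ (Lp.aestronglyMeasurable v))]
    simp only [japaneseBracket_mul_mul_neg]
    exact Lp.memLp v)

theorem coeFn_weightedOfL2 (s : ℝ) (v : L2 n) : weightedOfL2 s v =ᵐ[volume]
    fun x => ((japaneseBracket x ^ (-s) : ℝ) : ℂ) * v x :=
  (ae_weightedVolume_iff s).mp (MemLp.coeFn_toLp _)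

theorem norm_weightedOfL2 (s : ℝ) (v : L2 n) : ‖weightedOfL2 s v‖ = ‖v‖ := by
  rw [weightedOfL2, Lp.norm_toLp, eLpNorm_weightedVolume]
  simp only [japaneseBracket_mul_mul_neg]
  rfl

/-- The isometry `u ↦ ⟨x⟩^{-s} u` of `L²_{-s}` onto `L²`. -/
noncomputable def WeightedL2.mulWeight {s : ℝ} (u : WeightedL2 n (-s)) : L2 n :=
  MemLp.toLp (fun x => ((japaneseBracket x ^ (-s) : ℝ) : ℂ) * u x)
    ((memLp_weightedVolume_iff (-s) ((Lp.aestronglyMeasurable u).mono_ac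
      (absolutelyContinuous_weightedVolume _))).mp (Lp.memLp u))

theorem WeightedL2.coeFn_mulWeight {s : ℝ} (u : WeightedL2 n (-s)) : u.mulWeight =ᵐ[volume]
    fun x => ((japaneseBracket x ^ (-s) : ℝ) : ℂ) * u x :=
  MemLp.coeFn_toLp _

theorem japaneseBracket_rpow_neg_le_one {s : ℝ} (hs : 0 ≤ s) (x : EuclideanSpace ℝ (Fin n)) :
    japaneseBracket x ^ (-s) ≤ 1 :=
  Real.rpow_le_one_of_one_le_of_nonpos (one_le_japaneseBracket x) (by linarith)

theorem norm_japaneseBracket_mul_le {s : ℝ} (hs : 0 ≤ s) (x : EuclideanSpace ℝ (Fin n)) (z : ℂ) :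
    ‖((japaneseBracket x ^ (-s) : ℝ) : ℂ) * z‖ ≤ ‖z‖ := by
  rw [norm_mul, Complex.norm_real,
    Real.norm_of_nonneg (Real.rpow_nonneg (japaneseBracket_pos x).le _)]
  exact mul_le_of_le_one_left (norm_nonneg _) (japaneseBracket_rpow_neg_le_one hs x)

theorem memLp_japaneseBracket_mul {s : ℝ} (hs : 0 ≤ s) (v : L2 n) :
    MemLp (fun x => ((japaneseBracket x ^ (-s) : ℝ) : ℂ) * v x) 2 volume :=
  (Lp.memLp v).of_le (aestronglyMeasurable_japaneseBracket_mul _ (Lp.aestronglyMeasurable v))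
    (Eventually.of_forall fun x => norm_japaneseBracket_mul_le hs x _)

/-- The multiplication by `⟨x⟩^{-s}` on `L²`, for `s ≥ 0`. -/
noncomputable def weightMul {s : ℝ} (hs : 0 ≤ s) : L2 n →L[ℂ] L2 n :=
  LinearMap.mkContinuous
    { toFun := fun v => (memLp_japaneseBracket_mul hs v).toLp
      map_add' := fun v w => by
        refine Lp.ext ?_
        filter_upwards [(memLp_japaneseBracket_mul hs v).coeFn_toLp,
          (memLp_japaneseBracket_mul hs w).coeFn_toLp,
          (memLp_japaneseBracket_mul hs (v + w)).coeFn_toLp, Lp.coeFn_add v w,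
          Lp.coeFn_add (memLp_japaneseBracket_mul hs v).toLp
            (memLp_japaneseBracket_mul hs w).toLp] with x h1 h2 h3 h4 h5
        rw [h3, h5, Pi.add_apply, h1, h2, h4, Pi.add_apply, mul_add]
      map_smul' := fun c v => by
        refine Lp.ext ?_
        filter_upwards [(memLp_japaneseBracket_mul hs v).coeFn_toLp,
          (memLp_japaneseBracket_mul hs (c • v)).coeFn_toLp, Lp.coeFn_smul c v,
          Lp.coeFn_smul c (memLp_japaneseBracket_mul hs v).toLp] with x h1 h2 h3 h4
        rw [RingHom.id_apply, h2, h4, Pi.smul_apply, h1, h3, Pi.smul_apply, smul_eq_mul, smul_eq_mul]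
        ring } 1
    (fun v => by
      rw [one_mul]
      refine Lp.norm_le_norm_of_ae_le ?_
      filter_upwards [(memLp_japaneseBracket_mul hs v).coeFn_toLp] with x h1
      simp only [LinearMap.coe_mk, AddHom.coe_mk]
      rw [h1]
      exact norm_japaneseBracket_mul_le hs x _)

theorem coeFn_weightMul {s : ℝ} (hs : 0 ≤ s) (v : L2 n) : weightMul hs v =ᵐ[volume]
    fun x => ((japaneseBracket x ^ (-s) : ℝ) : ℂ) * v x :=
  (memLp_japaneseBracket_mul hs v).coeFn_toLp

theorem WeightedL2.coeFn_toL2 {s : ℝ} (hs : 0 ≤ s) (f : WeightedL2 n s) :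
    f.toL2 hs =ᵐ[volume] f := MemLp.coeFn_toLp _

/-- Together with `weightedPairing_weightedOfL2`, this moves the weight `⟨x⟩^{-s}` from the
evolution or from `A(λ)φ` onto the test vector, where the hypothesis on `A` applies. -/
theorem inner_toL2_weightedOfL2 {s : ℝ} (hs : 0 ≤ s) (v u : L2 n) :
    inner ℂ ((weightedOfL2 s v).toL2 hs) u = inner ℂ v (weightMul hs u) := by
  rw [L2.inner_def, L2.inner_def]
  refine integral_congr_ae ?_
  filter_upwards [WeightedL2.coeFn_toL2 hs (weightedOfL2 s v), coeFn_weightedOfL2 s v,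
    coeFn_weightMul hs u] with x h1 h2 h3
  rw [h1, h2, h3]
  simp only [RCLike.inner_apply, map_mul, Complex.conj_ofReal]
  ring

theorem weightedPairing_weightedOfL2 {s : ℝ} (u : WeightedL2 n (-s)) (v : L2 n) :
    weightedPairing u (weightedOfL2 s v) = inner ℂ v u.mulWeight := by
  rw [L2.inner_def, weightedPairing]
  refine integral_congr_ae ?_
  filter_upwards [coeFn_weightedOfL2 s v, u.coeFn_mulWeight] with x h2 h3
  rw [h2, h3]
  simp only [RCLike.inner_apply, map_mul, Complex.conj_ofReal]
  ring

theorem WeightedL2.toL2_add {s : ℝ} (hs : 0 ≤ s) (f g : WeightedL2 n s) :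
    (f + g).toL2 hs = f.toL2 hs + g.toL2 hs := by
  refine Lp.ext ?_
  filter_upwards [coeFn_toL2 hs f, coeFn_toL2 hs g, coeFn_toL2 hs (f + g),
    Lp.coeFn_add (f.toL2 hs) (g.toL2 hs), (ae_weightedVolume_iff s).mp (Lp.coeFn_add f g)]
    with x h1 h2 h3 h4 h5
  rw [h3, h4, h5, Pi.add_apply, Pi.add_apply, h1, h2]

theorem WeightedL2.toL2_smul {s : ℝ} (hs : 0 ≤ s) (c : ℂ) (f : WeightedL2 n s) :
    (c • f).toL2 hs = c • f.toL2 hs := by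
  refine Lp.ext ?_
  filter_upwards [coeFn_toL2 hs f, coeFn_toL2 hs (c • f),
    Lp.coeFn_smul c (f.toL2 hs), (ae_weightedVolume_iff s).mp (Lp.coeFn_smul c f)]
    with x h1 h2 h3 h4
  rw [h2, h3, h4, Pi.smul_apply, Pi.smul_apply, h1]

theorem WeightedL2.toL2_sub {s : ℝ} (hs : 0 ≤ s) (f g : WeightedL2 n s) :
    (f - g).toL2 hs = f.toL2 hs - g.toL2 hs := by
  rw [sub_eq_add_neg, ← neg_one_smul ℂ g, toL2_add, toL2_smul, neg_one_smul, sub_eq_add_neg]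

/-- Continuous functions of compact support belong to every weighted space and are dense in `L²`. -/
theorem WeightedL2.denseRange_toL2 {s : ℝ} (hs : 0 ≤ s) :
    DenseRange (fun f : WeightedL2 n s => f.toL2 hs) := by
  refine Metric.denseRange_iff.mpr fun φ r hr => ?_
  obtain ⟨g, hgc, hg, hgcont, hgmem⟩ := (Lp.memLp φ).exists_hasCompactSupport_eLpNorm_sub_le
    (by norm_num) (ε := ENNReal.ofReal (r / 2)) (by simpa using hr)
  have hgw : MemLp g 2 (weightedVolume n s) := by
    rw [memLp_weightedVolume_iff s hgmem.1]
    refine Continuous.memLp_of_hasCompactSupport ?_ hgc.mul_left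
    exact (Complex.continuous_ofReal.comp (continuous_japaneseBracket_rpow s)).mul hgcont
  refine ⟨hgw.toLp g, ?_⟩
  have h1 : (WeightedL2.toL2 hs (hgw.toLp g)) = hgmem.toLp g := by
    refine Lp.ext ?_
    filter_upwards [coeFn_toL2 hs (hgw.toLp g), (ae_weightedVolume_iff s).mp hgw.coeFn_toLp,
      hgmem.coeFn_toLp] with x h1 h2 h3
    rw [h1, h2, h3]
  have h2 : ‖φ - hgmem.toLp g‖ ≤ r / 2 := by
    rw [← ENNReal.ofReal_le_ofReal_iff (by positivity), ofReal_norm, Lp.enorm_def]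
    refine le_trans (le_of_eq (eLpNorm_congr_ae ?_)) hg
    filter_upwards [Lp.coeFn_sub φ (hgmem.toLp g), hgmem.coeFn_toLp] with x h1 h2
    rw [h1, Pi.sub_apply, h2, Pi.sub_apply]
  rw [h1, dist_eq_norm]
  linarith

/-- Orthonormal vectors lie at distance `√2 ≥ 1`, so balls of radius `1/2` about them are disjoint.
Countability is what permits exchanging the basis sum with the integrals. -/
theorem Orthonormal.countable_index {ι V : Type*} [NormedAddCommGroup V] [InnerProductSpace ℂ V]
    [TopologicalSpace.SeparableSpace V] {v : ι → V} (hv : Orthonormal ℂ v) : Countable ι := by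
  have hd : Pairwise (Function.onFun Disjoint fun i => Metric.ball (v i) (1 / 2)) := by
    intro i j hij
    refine Metric.ball_disjoint_ball ?_
    rw [dist_eq_norm]
    have h1 : ‖v i - v j‖ ^ 2 = 2 := by
      rw [@norm_sub_sq ℂ, hv.1 i, hv.1 j, hv.2 hij]
      norm_num
    nlinarith [norm_nonneg (v i - v j)]
  exact hd.countable_of_isOpen_disjoint (fun _ => Metric.isOpen_ball)
    fun i => Metric.nonempty_ball.mpr (by norm_num)

theorem exists_countable_hilbertBasis (n : ℕ) :
    ∃ (ι : Type) (_ : Countable ι), Nonempty (HilbertBasis ι ℂ (L2 n)) := by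
  obtain ⟨w, b, -⟩ := exists_hilbertBasis ℂ (L2 n)
  have : Fact ((2 : ℝ≥0∞) ≠ ∞) := ⟨by norm_num⟩
  exact ⟨w, b.orthonormal.countable_index, ⟨b⟩⟩

theorem HilbertBasis.tsum_enorm_inner_sq {ι V : Type*} [NormedAddCommGroup V]
    [InnerProductSpace ℂ V] (b : HilbertBasis ι ℂ V) (v : V) :
    ∑' i, ‖inner ℂ (b i) v‖ₑ ^ 2 = ‖v‖ₑ ^ 2 := by
  have h := b.hasSum_inner_mul_inner v v
  have h1 : ∀ i, inner ℂ v (b i) * inner ℂ (b i) v = ((‖inner ℂ (b i) v‖ ^ 2 : ℝ) : ℂ) := fun i => by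
    rw [← inner_conj_symm v, ← Complex.normSq_eq_conj_mul_self, Complex.normSq_eq_norm_sq]
  simp only [h1, inner_self_eq_norm_sq_to_K] at h
  have h2 : HasSum (fun i => ‖inner ℂ (b i) v‖ ^ 2) (‖v‖ ^ 2) :=
    Complex.hasSum_ofReal.mp (by rw [Complex.ofReal_pow]; exact h)
  rw [← ofReal_norm v, ← ENNReal.ofReal_pow (norm_nonneg _), ← h2.tsum_eq,
    ENNReal.ofReal_tsum_of_nonneg (fun _ => by positivity) h2.summable]
  refine tsum_congr fun i => ?_
  rw [ENNReal.ofReal_pow (norm_nonneg _), ofReal_norm]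

theorem L2.enorm_sq (v : L2 n) : ‖v‖ₑ ^ 2 = ∫⁻ x, ‖v x‖ₑ ^ 2 := by
  rw [Lp.enorm_def, eLpNorm_eq_lintegral_rpow_enorm_toReal (by norm_num) (by norm_num),
    ← ENNReal.rpow_natCast, ← ENNReal.rpow_mul]
  simp

theorem WeightedL2.lintegral_mulWeight {s : ℝ} (u : WeightedL2 n (-s)) (c : ℝ) :
    ∫⁻ x, ‖((c * japaneseBracket x ^ (-s) : ℝ) : ℂ) * u x‖ₑ ^ 2
      = ENNReal.ofReal (c ^ 2) * ‖u.mulWeight‖ₑ ^ 2 := by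
  rw [L2.enorm_sq, ← lintegral_const_mul' _ _ ENNReal.ofReal_ne_top]
  refine lintegral_congr_ae ?_
  filter_upwards [u.coeFn_mulWeight] with x hx
  rw [hx, Complex.ofReal_mul, mul_assoc, enorm_mul (c : ℂ), mul_pow]
  congr 1
  rw [← ofReal_norm, ← ENNReal.ofReal_pow (norm_nonneg _), Complex.norm_real, Real.norm_eq_abs,
    sq_abs]

end WeightedSpaceLemmas

/-! ### The spectral derivative as a density. -/

section SpectralDensity

namespace SpectralMeasure

variable {𝓗 : Type*} [NormedAddCommGroup 𝓗] [InnerProductSpace ℂ 𝓗] [CompleteSpace 𝓗]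
variable (E : SpectralMeasure 𝓗)

/-- The intervals are closed on the left because `E(λ)` stands for `E((-∞, λ))`. -/
theorem proj_Ico_apply {a b : ℝ} (hab : a ≤ b) (φ : 𝓗) :
    E.proj (Set.Ico a b) φ = E.proj (Set.Iio b) φ - E.proj (Set.Iio a) φ := by
  rw [eq_sub_iff_add_eq', ← E.proj_union_apply φ measurableSet_Iio measurableSet_Ico,
    Set.Iio_union_Ico_eq_Iio hab]
  exact Set.disjoint_left.mpr fun x hx hx' => absurd hx'.1 (not_le.mpr hx)

theorem norm_sq_proj_acProj {B : Set ℝ} (hB : MeasurableSet B) (φ : 𝓗) :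
    inner ℂ φ (E.proj B (E.acProj φ)) = ((‖E.proj B (E.acProj φ)‖ ^ 2 : ℝ) : ℂ) := by
  rw [E.inner_acProj_proj hB, inner_self_eq_norm_sq_to_K]
  norm_cast

theorem tendsto_smul_inner_proj_Ico {φ ψ : 𝓗} {d : ℂ} {lam : ℝ}
    (h : HasDerivAt (fun mu : ℝ => inner ℂ ψ (E.proj (Set.Iio mu) φ)) d lam) :
    Tendsto (fun mu : ℝ => (mu - lam)⁻¹ • inner ℂ ψ (E.proj (Set.Ico lam mu) φ))
      (𝓝[>] lam) (𝓝 d) := by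
  have h1 := (hasDerivAt_iff_tendsto_slope.mp h).mono_left
    (nhdsWithin_mono lam (fun x (hx : lam < x) => hx.ne'))
  refine h1.congr' ?_
  filter_upwards [self_mem_nhdsWithin] with mu hmu
  rw [slope_def_module, E.proj_Ico_apply (le_of_lt hmu), inner_sub_right]

/-- The right difference quotients are `‖E([λ, μ)) P_ac φ‖² / (μ - λ)`, which are real and
nonnegative. -/
theorem hasDerivAt_acProj_self {φ : 𝓗} {d : ℂ} {lam : ℝ}
    (h : HasDerivAt (fun mu : ℝ => inner ℂ φ (E.proj (Set.Iio mu) (E.acProj φ))) d lam) :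
    0 ≤ d.re ∧ d.im = 0 := by
  have ht := E.tendsto_smul_inner_proj_Ico h
  constructor
  · refine ge_of_tendsto ((Complex.continuous_re.tendsto d).comp ht) ?_
    filter_upwards [self_mem_nhdsWithin] with mu hmu
    have hmu' : 0 < mu - lam := sub_pos.mpr hmu
    simp only [Function.comp, E.norm_sq_proj_acProj measurableSet_Ico, Complex.smul_re,
      Complex.ofReal_re, smul_eq_mul]
    positivity
  · refine tendsto_nhds_unique ((Complex.continuous_im.tendsto d).comp ht) ?_
    refine tendsto_const_nhds.congr fun mu => ?_
    simp only [Function.comp, E.norm_sq_proj_acProj measurableSet_Ico, Complex.smul_im,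
      Complex.ofReal_im, smul_zero]

/-- The Cauchy-Schwarz inequality for the derivative of the spectral family. -/
theorem norm_sq_deriv_inner_le {φ ψ : 𝓗} {d d₁ d₂ : ℂ} {lam : ℝ}
    (h : HasDerivAt (fun mu : ℝ => inner ℂ ψ (E.proj (Set.Iio mu) (E.acProj φ))) d lam)
    (h₁ : HasDerivAt (fun mu : ℝ => inner ℂ φ (E.proj (Set.Iio mu) (E.acProj φ))) d₁ lam)
    (h₂ : HasDerivAt (fun mu : ℝ => inner ℂ ψ (E.proj (Set.Iio mu) (E.acProj ψ))) d₂ lam) :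
    ‖d‖ ^ 2 ≤ d₁.re * d₂.re := by
  refine le_of_tendsto_of_tendsto ((E.tendsto_smul_inner_proj_Ico h).norm.pow 2)
    (((Complex.continuous_re.tendsto _).comp (E.tendsto_smul_inner_proj_Ico h₁)).mul
      ((Complex.continuous_re.tendsto _).comp (E.tendsto_smul_inner_proj_Ico h₂))) ?_
  filter_upwards [self_mem_nhdsWithin] with mu hmu
  have hmu' : 0 < (mu - lam)⁻¹ := inv_pos.mpr (sub_pos.mpr hmu)
  simp only [Function.comp, E.norm_sq_proj_acProj measurableSet_Ico, Complex.smul_re,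
    Complex.ofReal_re, smul_eq_mul]
  rw [E.inner_acProj_proj measurableSet_Ico, norm_smul, Real.norm_of_nonneg hmu'.le]
  have := norm_inner_le_norm (𝕜 := ℂ) (E.proj (Set.Ico lam mu) (E.acProj ψ))
    (E.proj (Set.Ico lam mu) (E.acProj φ))
  calc _ ≤ ((mu - lam)⁻¹ * (‖E.proj (Set.Ico lam mu) (E.acProj ψ)‖
          * ‖E.proj (Set.Ico lam mu) (E.acProj φ)‖)) ^ 2 := by gcongr
    _ = _ := by ring

/-- An open set is a countable union of half-open rational intervals whose closures it contains, and
on each of them the half-open subintervals determine the measure. -/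
theorem measure_restrict_eq_of_Ico {μ ν : Measure ℝ} [IsLocallyFiniteMeasure μ] {J : Set ℝ}
    (hJ : IsOpen J) (h : ∀ a b : ℝ, a ≤ b → Set.Icc a b ⊆ J →
      μ (Set.Ico a b) = ν (Set.Ico a b)) : μ.restrict J = ν.restrict J := by
  let S : {q : ℚ × ℚ // Set.Icc (q.1 : ℝ) q.2 ⊆ J} → Set ℝ := fun q => Set.Ico (q.1.1 : ℝ) q.1.2
  have hS : J = ⋃ q, S q := by
    ext x
    simp only [Set.mem_iUnion, S]
    constructor
    · intro hx
      obtain ⟨ε, hε, hball⟩ := Metric.isOpen_iff.mp hJ x hx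
      obtain ⟨p, hp1, hp2⟩ := exists_rat_btwn (sub_lt_self x hε)
      obtain ⟨q, hq1, hq2⟩ := exists_rat_btwn (lt_add_of_pos_right x hε)
      refine ⟨⟨(p, q), fun y hy => hball ?_⟩, hp2.le, hq1⟩
      rw [Real.ball_eq_Ioo]
      exact ⟨hp1.trans_le hy.1, hy.2.trans_lt hq2⟩
    · rintro ⟨q, hq⟩
      exact q.2 ⟨hq.1, hq.2.le⟩
  rw [hS, Measure.restrict_iUnion_congr]
  rintro ⟨⟨p, q⟩, hpq⟩
  refine Measure.ext_of_Ico _ _ fun a b _ => ?_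
  simp only [S]
  rw [Measure.restrict_apply measurableSet_Ico, Measure.restrict_apply measurableSet_Ico,
    Set.Ico_inter_Ico]
  rcases le_total (max a (p : ℝ)) (min b (q : ℝ)) with hle | hle
  · exact h _ _ hle ((Set.Icc_subset_Icc (le_max_right _ _) (min_le_right _ _)).trans hpq)
  · rw [Set.Ico_eq_empty (not_lt.mpr hle), measure_empty, measure_empty]

/-- On `J`, the scalar spectral measure of `P_ac φ` has the density `d/dλ (E(λ) P_ac φ, φ)`. -/
theorem scalarMeasure_restrict_eq_withDensity {φ : 𝓗} {d : ℝ → ℂ} {J : Set ℝ} (hJ : IsOpen J)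
    (h : ∀ lam ∈ J,
      HasDerivAt (fun mu : ℝ => inner ℂ φ (E.proj (Set.Iio mu) (E.acProj φ))) (d lam) lam)
    (hd : ContinuousOn d J) :
    (E.scalarMeasure (E.acProj φ)).restrict J
      = (volume.withDensity fun lam => ENNReal.ofReal (d lam).re).restrict J := by
  refine measure_restrict_eq_of_Ico hJ fun a b hab hsub => ?_
  have hc : ContinuousOn (fun lam => (d lam).re) (Set.Icc a b) :=
    Complex.continuous_re.comp_continuousOn (hd.mono hsub)
  have hint : IntervalIntegrable (fun lam => (d lam).re) volume a b :=
    (hc.mono (by rw [Set.uIcc_of_le hab])).intervalIntegrable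
  -- The fundamental theorem of calculus applies because the derivative is continuous on the compact
  -- interval `[a, b] ⊆ J`.
  have hF := intervalIntegral.integral_eq_sub_of_hasDerivAt
    (f := fun mu : ℝ => (inner ℂ φ (E.proj (Set.Iio mu) (E.acProj φ))).re)
    (f' := fun lam => (d lam).re) (a := a) (b := b) (fun x hx => by
      rw [Set.uIcc_of_le hab] at hx
      exact Complex.reCLM.hasFDerivAt.comp_hasDerivAt x (h x (hsub hx))) hint
  have h1 : ‖E.proj (Set.Ico a b) (E.acProj φ)‖ ^ 2 = ∫ lam in Set.Ico a b, (d lam).re := by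
    rw [integral_Ico_eq_integral_Ioc, ← intervalIntegral.integral_of_le hab, hF,
      ← Complex.sub_re, ← inner_sub_right, ← E.proj_Ico_apply hab,
      E.norm_sq_proj_acProj measurableSet_Ico, Complex.ofReal_re]
  rw [E.scalarMeasure_apply _ measurableSet_Ico, withDensity_apply _ measurableSet_Ico, h1,
    ofReal_integral_eq_lintegral_ofReal]
  · exact (hc.integrableOn_Icc).mono_set Set.Ico_subset_Icc_self
  · filter_upwards [ae_restrict_mem measurableSet_Ico] with x hx
    exact (E.hasDerivAt_acProj_self (h x (hsub (Set.Ico_subset_Icc_self hx)))).1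

/-- The diagonal density is real and nonnegative, and its integral over `B` is `‖E(B) P_ac φ‖²`;
integrability comes from this finite mass, even if `B` reaches the boundary of `J`. -/
theorem integral_density_self {φ : 𝓗} {d : ℝ → ℂ} {J : Set ℝ} (hJ : IsOpen J)
    (h : ∀ lam ∈ J,
      HasDerivAt (fun mu : ℝ => inner ℂ φ (E.proj (Set.Iio mu) (E.acProj φ))) (d lam) lam)
    (hd : ContinuousOn d J) {B : Set ℝ} (hB : MeasurableSet B) (hBJ : B ⊆ J) :
    IntegrableOn d B ∧ inner ℂ φ (E.proj B (E.acProj φ)) = ∫ lam in B, d lam := by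
  have hae : ∀ᵐ lam ∂(volume.restrict B), ((d lam).re : ℂ) = d lam := by
    filter_upwards [ae_restrict_mem hB] with x hx
    exact Complex.ext rfl (by simpa using (E.hasDerivAt_acProj_self (h x (hBJ hx))).2.symm)
  have hnn : 0 ≤ᵐ[volume.restrict B] fun lam => (d lam).re := by
    filter_upwards [ae_restrict_mem hB] with x hx
    exact (E.hasDerivAt_acProj_self (h x (hBJ hx))).1
  have hm : AEStronglyMeasurable (fun lam => (d lam).re) (volume.restrict B) :=
    ((Complex.continuous_re.comp_continuousOn hd).aestronglyMeasurable hJ.measurableSet).mono_set hBJ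
  have hlin : ENNReal.ofReal (‖E.proj B (E.acProj φ)‖ ^ 2)
      = ∫⁻ lam in B, ENNReal.ofReal (d lam).re := by
    have h1 := congrArg (fun μ : Measure ℝ => μ B)
      (E.scalarMeasure_restrict_eq_withDensity hJ h hd)
    simp only [Measure.restrict_apply hB, Set.inter_eq_left.mpr hBJ] at h1
    rwa [E.scalarMeasure_apply _ hB, withDensity_apply _ hB] at h1
  have hi : IntegrableOn (fun lam => (d lam).re) B := by
    refine ⟨hm, ?_⟩
    rw [hasFiniteIntegral_iff_ofReal hnn, ← hlin]
    exact ENNReal.ofReal_lt_top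
  refine ⟨(hi.ofReal (𝕜 := ℂ)).congr hae, ?_⟩
  rw [E.norm_sq_proj_acProj hB, ← integral_congr_ae hae, integral_complex_ofReal]
  congr 1
  rw [integral_eq_lintegral_of_nonneg_ae hnn hm, ← hlin, ENNReal.toReal_ofReal (by positivity)]

/-- Reduces off-diagonal matrix elements to diagonal ones, whose densities are nonnegative. -/
theorem inner_proj_acProj_polarization {B : Set ℝ} (hB : MeasurableSet B) (φ ψ : 𝓗) :
    inner ℂ ψ (E.proj B (E.acProj φ)) =
      (inner ℂ (φ + ψ) (E.proj B (E.acProj (φ + ψ)))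
        - inner ℂ (φ - ψ) (E.proj B (E.acProj (φ - ψ)))
        + Complex.I * inner ℂ (φ + Complex.I • ψ) (E.proj B (E.acProj (φ + Complex.I • ψ)))
        - Complex.I * inner ℂ (φ - Complex.I • ψ) (E.proj B (E.acProj (φ - Complex.I • ψ)))) / 4 := by
  have h1 : ∀ x y : 𝓗, inner ℂ y (E.proj B (E.acProj x)) = inner ℂ (E.proj B (E.acProj y)) x := by
    intro x y
    rw [E.inner_proj_right hB, ← E.acProj_proj hB, ← E.inner_acProj_right, E.inner_acProj_right,
      E.acProj_proj hB]
  simp only [h1]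
  exact inner_map_polarization ((E.proj B).comp E.acProj : 𝓗 →L[ℂ] 𝓗).toLinearMap φ ψ

end SpectralMeasure

end SpectralDensity

/-! ### Squares and square roots in `[0, ∞]`. -/

section SquareNorms

theorem ENNReal.sq_rpow_half (a : ℝ≥0∞) : (a ^ 2) ^ (1 / 2 : ℝ) = a := by
  rw [← ENNReal.rpow_natCast, ← ENNReal.rpow_mul]
  simp

theorem ENNReal.rpow_half_sq (a : ℝ≥0∞) : (a ^ (1 / 2 : ℝ)) ^ 2 = a := by
  rw [← ENNReal.rpow_natCast, ← ENNReal.rpow_mul]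
  simp

theorem eLpNorm_two_eq_lintegral {α : Type*} [MeasurableSpace α] (f : α → ℂ) (μ : Measure α) :
    eLpNorm f 2 μ = (∫⁻ x, ‖f x‖ₑ ^ 2 ∂μ) ^ (1 / 2 : ℝ) := by
  rw [eLpNorm_eq_lintegral_rpow_enorm_toReal (by norm_num) (by norm_num)]
  simp

theorem enorm_sq_eq_ofReal (z : ℂ) : ‖z‖ₑ ^ 2 = ENNReal.ofReal (‖z‖ ^ 2) := by
  rw [ENNReal.ofReal_pow (norm_nonneg _), ofReal_norm]

end SquareNorms

/-! ### Spectral integrals in terms of `A(λ)`. -/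

section WeakSpectralDerivative

variable {n : ℕ} {s : ℝ} {E : SpectralMeasure (L2 n)} {hs : 0 ≤ s} {J : Set ℝ}
  {A : ℝ → WeightedL2 n s →L[ℂ] WeightedL2 n (-s)}

/-- `A` is the weakly continuous weak derivative of `E(λ) P_ac` on the open set `J`. -/
structure IsWeakSpectralDerivative (E : SpectralMeasure (L2 n)) (hs : 0 ≤ s) (J : Set ℝ)
    (A : ℝ → WeightedL2 n s →L[ℂ] WeightedL2 n (-s)) : Prop where
  isOpen : IsOpen J
  hasDerivAt : ∀ lam ∈ J, ∀ f g : WeightedL2 n s,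
    HasDerivAt (fun mu : ℝ => inner ℂ (g.toL2 hs) (E.proj (Set.Iio mu) (E.acProj (f.toL2 hs))))
      (weightedPairing (A lam f) g) lam
  continuousOn : ∀ f g : WeightedL2 n s, ContinuousOn (fun lam => weightedPairing (A lam f) g) J

namespace IsWeakSpectralDerivative

theorem pairing_self (h : IsWeakSpectralDerivative E hs J A) {lam : ℝ} (hlam : lam ∈ J)
    (f : WeightedL2 n s) :
    0 ≤ (weightedPairing (A lam f) f).re ∧ (weightedPairing (A lam f) f).im = 0 :=
  E.hasDerivAt_acProj_self (h.hasDerivAt lam hlam f f)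

theorem norm_sq_pairing_le (h : IsWeakSpectralDerivative E hs J A) {lam : ℝ} (hlam : lam ∈ J)
    (f g : WeightedL2 n s) : ‖weightedPairing (A lam f) g‖ ^ 2
      ≤ (weightedPairing (A lam f) f).re * (weightedPairing (A lam g) g).re :=
  E.norm_sq_deriv_inner_le (h.hasDerivAt lam hlam f g) (h.hasDerivAt lam hlam f f)
    (h.hasDerivAt lam hlam g g)

/-- Both sides are derivatives at `λ` of the same function, by polarization for `E((-∞, μ)) P_ac`;
derivatives are unique. -/
theorem pairing_polarization (h : IsWeakSpectralDerivative E hs J A) {lam : ℝ} (hlam : lam ∈ J)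
    (f g : WeightedL2 n s) : weightedPairing (A lam f) g =
      (weightedPairing (A lam (f + g)) (f + g) - weightedPairing (A lam (f - g)) (f - g)
        + Complex.I * weightedPairing (A lam (f + Complex.I • g)) (f + Complex.I • g)
        - Complex.I * weightedPairing (A lam (f - Complex.I • g)) (f - Complex.I • g)) / 4 := by
  refine (h.hasDerivAt lam hlam f g).unique ?_
  have h1 := ((((h.hasDerivAt lam hlam (f + g) (f + g)).sub
    (h.hasDerivAt lam hlam (f - g) (f - g))).add
    ((h.hasDerivAt lam hlam (f + Complex.I • g) (f + Complex.I • g)).const_mul Complex.I)).sub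
    ((h.hasDerivAt lam hlam (f - Complex.I • g) (f - Complex.I • g)).const_mul Complex.I)).div_const 4
  refine h1.congr_of_eventuallyEq (Eventually.of_forall fun mu => ?_)
  simp only [WeightedL2.toL2_add, WeightedL2.toL2_sub, WeightedL2.toL2_smul]
  exact E.inner_proj_acProj_polarization measurableSet_Iio _ _

theorem integral_pairing (h : IsWeakSpectralDerivative E hs J A) {B : Set ℝ}
    (hB : MeasurableSet B) (hBJ : B ⊆ J) (f g : WeightedL2 n s) :
    IntegrableOn (fun lam => weightedPairing (A lam f) g) B ∧
      inner ℂ (g.toL2 hs) (E.proj B (E.acProj (f.toL2 hs)))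
        = ∫ lam in B, weightedPairing (A lam f) g := by
  have key : ∀ k : WeightedL2 n s, _ := fun k => E.integral_density_self h.isOpen
    (fun lam hlam => h.hasDerivAt lam hlam k k) (h.continuousOn k k) hB hBJ
  obtain ⟨i1, e1⟩ := key (f + g)
  obtain ⟨i2, e2⟩ := key (f - g)
  obtain ⟨i3, e3⟩ := key (f + Complex.I • g)
  obtain ⟨i4, e4⟩ := key (f - Complex.I • g)
  have hae := (ae_restrict_mem (μ := volume) hB).mono fun lam hlam =>
    (h.pairing_polarization (hBJ hlam) f g).symm
  constructor
  · exact ((((i1.sub i2).add (i3.const_mul _)).sub (i4.const_mul _)).div_const 4).congr hae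
  · rw [← integral_congr_ae hae, integral_div, integral_sub, integral_add, integral_sub,
      integral_const_mul, integral_const_mul, ← e1, ← e2, ← e3, ← e4]
    · simp only [WeightedL2.toL2_add, WeightedL2.toL2_sub, WeightedL2.toL2_smul]
      exact E.inner_proj_acProj_polarization hB _ _
    · exact i1
    · exact i2
    · exact i1.sub i2
    · exact i3.const_mul _
    · exact (i1.sub i2).add (i3.const_mul _)
    · exact i4.const_mul _

theorem scalarMeasure_eq (h : IsWeakSpectralDerivative E hs J A) {B : Set ℝ}
    (hB : MeasurableSet B) (hBJ : B ⊆ J) (f : WeightedL2 n s) :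
    E.scalarMeasure (E.proj B (E.acProj (f.toL2 hs)))
      = (volume.restrict B).withDensity
          fun lam => ENNReal.ofReal (weightedPairing (A lam f) f).re := by
  have h1 := E.scalarMeasure_restrict_eq_withDensity h.isOpen
    (fun lam hlam => h.hasDerivAt lam hlam f f) (h.continuousOn f f)
  have h2 := congrArg (fun μ : Measure ℝ => μ.restrict B) h1
  simp only [Measure.restrict_restrict hB, Set.inter_eq_left.mpr hBJ] at h2
  rw [E.scalarMeasure_proj hB, h2, restrict_withDensity hB]

theorem aemeasurable_pairing (h : IsWeakSpectralDerivative E hs J A) {B : Set ℝ}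
    (hBJ : B ⊆ J) (f g : WeightedL2 n s) :
    AEMeasurable (fun lam => weightedPairing (A lam f) g) (volume.restrict B) :=
  ((h.continuousOn f g).aemeasurable h.isOpen.measurableSet).mono_set hBJ

theorem lintegral_pairing_self (h : IsWeakSpectralDerivative E hs J A) {B : Set ℝ}
    (hB : MeasurableSet B) (hBJ : B ⊆ J) (f : WeightedL2 n s) :
    ∫⁻ lam in B, ENNReal.ofReal (weightedPairing (A lam f) f).re
      = ‖E.proj B (E.acProj (f.toL2 hs))‖ₑ ^ 2 := by
  have h1 := congrArg (fun μ : Measure ℝ => μ Set.univ) (h.scalarMeasure_eq hB hBJ f)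
  simp only [E.scalarMeasure_apply _ MeasurableSet.univ,
    withDensity_apply _ MeasurableSet.univ, Measure.restrict_univ] at h1
  rw [← h1, E.proj_univ, ENNReal.ofReal_pow (norm_nonneg _), ofReal_norm]
  rfl

/-- Cauchy-Schwarz twice: pointwise for the nonnegative form `A(λ)`, then in `λ`. Bounding by the
`L²` norm of `F` in the scalar measure lets `inner_apply` pass from simple functions to general
ones. -/
theorem lintegral_mul_pairing_le (h : IsWeakSpectralDerivative E hs J A) {B : Set ℝ}
    (hB : MeasurableSet B) (hBJ : B ⊆ J) (f g : WeightedL2 n s) {F : ℝ → ℂ}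
    (hF : AEStronglyMeasurable F (volume.restrict B)) :
    ∫⁻ lam in B, ‖F lam * weightedPairing (A lam f) g‖ₑ
      ≤ eLpNorm F 2 (E.scalarMeasure (E.proj B (E.acProj (f.toL2 hs))))
        * ‖E.proj B (E.acProj (g.toL2 hs))‖ₑ := by
  let p : ℝ → ℝ≥0∞ := fun lam =>
    ‖F lam‖ₑ * ENNReal.ofReal (weightedPairing (A lam f) f).re ^ (1 / 2 : ℝ)
  let q : ℝ → ℝ≥0∞ := fun lam => ENNReal.ofReal (weightedPairing (A lam g) g).re ^ (1 / 2 : ℝ)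
  have hm : ∀ k : WeightedL2 n s, AEMeasurable
      (fun lam => ENNReal.ofReal (weightedPairing (A lam k) k).re) (volume.restrict B) := fun k =>
    (Complex.measurable_re.comp_aemeasurable (h.aemeasurable_pairing hBJ k k)).ennreal_ofReal
  have hp : AEMeasurable p (volume.restrict B) := hF.enorm.mul ((hm f).pow_const _)
  have hq : AEMeasurable q (volume.restrict B) := (hm g).pow_const _
  have hle : ∫⁻ lam in B, ‖F lam * weightedPairing (A lam f) g‖ₑ ≤ ∫⁻ lam in B, (p * q) lam := by
    refine lintegral_mono_ae ?_
    filter_upwards [ae_restrict_mem hB] with lam hlam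
    rw [Pi.mul_apply, enorm_mul, mul_assoc, ← ENNReal.mul_rpow_of_nonneg _ _ (by norm_num)]
    gcongr
    rw [← ENNReal.ofReal_mul (h.pairing_self (hBJ hlam) f).1,
      ← ENNReal.sq_rpow_half ‖weightedPairing (A lam f) g‖ₑ, enorm_sq_eq_ofReal]
    gcongr
    exact h.norm_sq_pairing_le (hBJ hlam) f g
  refine hle.trans ((ENNReal.lintegral_mul_le_Lp_mul_Lq _ Real.HolderConjugate.two_two hp hq).trans
    (le_of_eq ?_))
  simp only [ENNReal.rpow_ofNat]
  congr 1
  · rw [eLpNorm_two_eq_lintegral, h.scalarMeasure_eq hB hBJ,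
      lintegral_withDensity_eq_lintegral_mul_non_measurable₀ _ (hm f)
        (Eventually.of_forall fun x => ENNReal.ofReal_lt_top)]
    congr 1
    refine lintegral_congr fun lam => ?_
    simp only [p, Pi.mul_apply]
    rw [mul_pow, ENNReal.rpow_half_sq, mul_comm]
  · simp only [q, ENNReal.rpow_half_sq]
    rw [h.lintegral_pairing_self hB hBJ, ENNReal.sq_rpow_half]

/-- `(f(H) E(B) P_ac φ, ψ) = ∫_B f(λ) (A(λ)φ, ψ) dλ`. -/
theorem inner_apply (h : IsWeakSpectralDerivative E hs J A) {B : Set ℝ}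
    (hB : MeasurableSet B) (hBJ : B ⊆ J) (f g : WeightedL2 n s) {F : ℝ → ℂ}
    (hF : AEStronglyMeasurable F (volume.restrict B))
    (hF2 : MemLp F 2 (E.scalarMeasure (E.proj B (E.acProj (f.toL2 hs))))) :
    IntegrableOn (fun lam => F lam * weightedPairing (A lam f) g) B ∧
      inner ℂ (g.toL2 hs) (E.apply F (E.proj B (E.acProj (f.toL2 hs))))
        = ∫ lam in B, F lam * weightedPairing (A lam f) g := by
  have hint : ∀ G : ℝ → ℂ, AEStronglyMeasurable G (volume.restrict B) →
      MemLp G 2 (E.scalarMeasure (E.proj B (E.acProj (f.toL2 hs)))) →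
      IntegrableOn (fun lam => G lam * weightedPairing (A lam f) g) B := fun G hG hG2 =>
    ⟨hG.mul (h.aemeasurable_pairing hBJ f g).aestronglyMeasurable,
      (h.lintegral_mul_pairing_le hB hBJ f g hG).trans_lt (ENNReal.mul_lt_top hG2.2 enorm_lt_top)⟩
  have hsimple : ∀ G : SimpleFunc ℝ ℂ,
      inner ℂ (g.toL2 hs) (E.simpleApply G (E.proj B (E.acProj (f.toL2 hs))))
        = ∫ lam in B, G lam * weightedPairing (A lam f) g := by
    intro G
    have h1 : ∀ lam, G lam * weightedPairing (A lam f) g = ∑ c ∈ G.range,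
        (G ⁻¹' {c}).indicator (fun lam => c * weightedPairing (A lam f) g) lam := by
      intro lam
      rw [Finset.sum_eq_single (G lam)]
      · rw [Set.indicator_of_mem (by simp)]
      · intro c _ hc
        exact Set.indicator_of_notMem (by simpa using hc.symm) _
      · intro hc
        exact absurd (G.mem_range_self lam) hc
    simp only [h1]
    rw [integral_finsetSum, SpectralMeasure.simpleApply, inner_sum]
    · refine Finset.sum_congr rfl fun c _ => ?_
      rw [integral_indicator (G.measurableSet_fiber c), Measure.restrict_restrict
        (G.measurableSet_fiber c), integral_const_mul, inner_smul_right,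
        E.proj_proj (G.measurableSet_fiber c) hB]
      congr 1
      exact (h.integral_pairing ((G.measurableSet_fiber c).inter hB)
        (Set.inter_subset_right.trans hBJ) f g).2
    · intro c _
      exact ((h.integral_pairing hB hBJ f g).1.const_mul c).indicator (G.measurableSet_fiber c)
  refine ⟨hint F hF hF2, ?_⟩
  rw [← sub_eq_zero, ← norm_le_zero_iff]
  refine le_of_forall_pos_le_add fun ε hε => ?_
  set v := g.toL2 hs with hv
  -- Two errors of size `‖v‖` times this constant add up to at most `ε`; the `+ 1` covers `v = 0`.
  have hpos : 0 < ε / (2 * (‖v‖ + 1)) := by positivity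
  obtain ⟨G, hG⟩ := SpectralMeasure.exists_simpleFunc_eLpNorm_sub_le hF2 hpos
  set p := E.proj B (E.acProj (f.toL2 hs)) with hp
  have e1 : ‖E.apply F p - E.simpleApply G p‖ ≤ ε / (2 * (‖v‖ + 1)) := by
    have := ((E.isApply_apply hF2).enorm_sub_simpleApply_le G).trans hG
    rwa [← ofReal_norm, ENNReal.ofReal_le_ofReal_iff hpos.le] at this
  have e2 : ‖inner ℂ v (E.apply F p - E.simpleApply G p)‖ ≤ ‖v‖ * (ε / (2 * (‖v‖ + 1))) :=
    (norm_inner_le_norm _ _).trans (by gcongr)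
  have hG2 : MemLp G 2 (E.scalarMeasure p) := G.memLp_of_isFiniteMeasure 2 _
  have e3 : ‖∫ lam in B, (F lam - G lam) * weightedPairing (A lam f) g‖
      ≤ ‖v‖ * (ε / (2 * (‖v‖ + 1))) := by
    rw [← ENNReal.ofReal_le_ofReal_iff (by positivity), ofReal_norm]
    refine (enorm_integral_le_lintegral_enorm _).trans
      ((h.lintegral_mul_pairing_le hB hBJ f g (hF.sub G.aestronglyMeasurable)).trans ?_)
    rw [mul_comm, ENNReal.ofReal_mul (norm_nonneg _)]
    refine mul_le_mul' ?_ hG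
    rw [← ofReal_norm]
    exact ENNReal.ofReal_le_ofReal ((E.norm_proj_le hB _).trans (E.norm_acProj_le _))
  have e4 : inner ℂ v (E.apply F p) - ∫ lam in B, F lam * weightedPairing (A lam f) g
      = inner ℂ v (E.apply F p - E.simpleApply G p)
        - ∫ lam in B, (F lam - G lam) * weightedPairing (A lam f) g := by
    simp only [sub_mul]
    rw [integral_sub (hint F hF hF2) (hint G G.aestronglyMeasurable hG2), inner_sub_right,
      hsimple]
    ring
  rw [e4]
  refine (norm_sub_le _ _).trans ((add_le_add e2 e3).trans ?_)
  have : ‖v‖ * (ε / (2 * (‖v‖ + 1))) + ‖v‖ * (ε / (2 * (‖v‖ + 1))) = ε * (‖v‖ / (‖v‖ + 1)) := by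
    field_simp
    ring
  rw [this, zero_add]
  refine mul_le_of_le_one_right hε.le ((div_le_one (by positivity)).mpr (by linarith))

end IsWeakSpectralDerivative
end WeakSpectralDerivative

/-! ### Phase functions and oscillatory integrals. -/

section PhaseFunctions

/-- `a` is an admissible phase function on `J`, with the finite exceptional set `N`. -/
structure IsPhase (J N : Set ℝ) (a : ℝ → ℝ) : Prop where
  isOpen : IsOpen J
  finite : N.Finite
  contDiffOn : ContDiffOn ℝ 1 a (J \ N)
  deriv_pos : ∀ lam ∈ J \ N, 0 < deriv a lam
  injOn : Set.InjOn a (J \ N)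

variable {J N : Set ℝ} {a : ℝ → ℝ}

theorem IsPhase.isOpen_diff (ha : IsPhase J N a) : IsOpen (J \ N) :=
  ha.isOpen.sdiff ha.finite.isClosed

theorem IsPhase.hasDerivAt (ha : IsPhase J N a) {lam : ℝ} (h : lam ∈ J \ N) :
    HasDerivAt a (deriv a lam) lam :=
  ((ha.contDiffOn.contDiffAt (ha.isOpen_diff.mem_nhds h)).differentiableAt one_ne_zero).hasDerivAt

theorem IsPhase.restrict_diff (ha : IsPhase J N a) (B : Set ℝ) :
    (volume : Measure ℝ).restrict (B \ N) = volume.restrict B :=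
  Measure.restrict_congr_set (sdiff_null_ae_eq_self (ha.finite.measure_zero _))

theorem IsPhase.aemeasurable (ha : IsPhase J N a) {B : Set ℝ} (hBJ : B ⊆ J) :
    AEMeasurable a (volume.restrict B) := by
  have h := ha.contDiffOn.continuousOn.aemeasurable (μ := volume) ha.isOpen_diff.measurableSet
  rw [ha.restrict_diff] at h
  exact h.mono_set hBJ

/-- The integrand `σ(λ) e^{ita(λ)}`. -/
noncomputable def phaseFactor (σ a : ℝ → ℝ) (t lam : ℝ) : ℂ :=
  (σ lam : ℂ) * Complex.exp (Complex.I * t * a lam)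

theorem norm_phaseFactor (σ a : ℝ → ℝ) (t lam : ℝ) : ‖phaseFactor σ a t lam‖ = |σ lam| := by
  rw [phaseFactor, norm_mul, Complex.norm_real, Real.norm_eq_abs,
    show Complex.I * t * a lam = ((t * a lam : ℝ) : ℂ) * Complex.I by push_cast; ring,
    Complex.norm_exp_ofReal_mul_I, mul_one]

theorem IsPhase.aestronglyMeasurable_phaseFactor (ha : IsPhase J N a) {σ : ℝ → ℝ}
    (hσ : ContinuousOn σ J) {B : Set ℝ} (hBJ : B ⊆ J) (t : ℝ) :
    AEStronglyMeasurable (phaseFactor σ a t) (volume.restrict B) := by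
  have h1 : AEMeasurable σ (volume.restrict B) :=
    (hσ.aemeasurable ha.isOpen.measurableSet).mono_set hBJ
  have h2 := ha.aemeasurable hBJ
  exact ((Complex.measurable_ofReal.comp_aemeasurable h1).mul (Complex.measurable_exp.comp_aemeasurable
    ((Complex.measurable_ofReal.comp_aemeasurable h2).const_mul _))).aestronglyMeasurable

/-- The change of variables `μ = a(λ)` followed by Plancherel's theorem. -/
theorem IsPhase.lintegral_oscillatory_integral_sq (ha : IsPhase J N a) (σ : ℝ → ℝ) {h : ℝ → ℂ}
    {B : Set ℝ} (hB : MeasurableSet B) (hBJ : B ⊆ J)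
    (hint : IntegrableOn (fun lam => (σ lam : ℂ) * h lam) B) :
    ∫⁻ t : ℝ, ‖∫ lam in B, phaseFactor σ a t lam * h lam‖ₑ ^ 2
      = ENNReal.ofReal (2 * Real.pi) * ∫⁻ lam in B,
          ENNReal.ofReal ((σ lam / Real.sqrt (deriv a lam)) ^ 2) * ‖h lam‖ₑ ^ 2 := by
  rw [← ha.restrict_diff B]
  set S := B \ N with hS
  have hSJ : S ⊆ J \ N := Set.sdiff_subset_sdiff_left hBJ
  have hSm : MeasurableSet S := hB.diff ha.finite.measurableSet
  have hd : ∀ x ∈ S, HasDerivWithinAt a (deriv a x) S x := fun x hx =>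
    (ha.hasDerivAt (hSJ hx)).hasDerivWithinAt
  have hinj : Set.InjOn a S := ha.injOn.mono hSJ
  have hSa : MeasurableSet (a '' S) :=
    hSm.image_of_continuousOn_injOn (ha.contDiffOn.continuousOn.mono hSJ) hinj
  let b := Function.invFunOn a S
  have hb : ∀ x ∈ S, b (a x) = x := fun x hx => hinj.leftInvOn_invFunOn hx
  -- The Jacobian `a'` is absorbed in `G`, so the `λ`-integral becomes the integral of `e^{itμ}
  -- G(μ)` over the image of `a`. Removing the null set `N` from `B` has made `a` injective with
  -- positive derivative.
  let G : ℝ → ℂ := fun mu => (σ (b mu) : ℂ) * h (b mu) / ((deriv a (b mu) : ℝ) : ℂ)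
  have hG : ∀ x ∈ S, |deriv a x| • G (a x) = (σ x : ℂ) * h x := by
    intro x hx
    have hpos := ha.deriv_pos x (hSJ hx)
    have hne : ((deriv a x : ℝ) : ℂ) ≠ 0 := by exact_mod_cast hpos.ne'
    simp only [G, hb x hx, abs_of_pos hpos, Complex.real_smul]
    field_simp
  have hGint : IntegrableOn G (a '' S) := by
    rw [integrableOn_image_iff_integrableOn_abs_deriv_smul hSm hd hinj]
    exact (hint.mono_set Set.sdiff_subset).congr_fun (fun x hx => (hG x hx).symm) hSm
  have h1 : ∀ t : ℝ, ∫ lam in S, phaseFactor σ a t lam * h lam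
      = ∫ mu : ℝ, Complex.exp (Complex.I * t * mu) * (a '' S).indicator G mu := by
    intro t
    have h2 : (fun mu : ℝ => Complex.exp (Complex.I * t * mu) * (a '' S).indicator G mu)
        = (a '' S).indicator fun mu : ℝ => Complex.exp (Complex.I * t * mu) * G mu := by
      ext mu
      by_cases hmu : mu ∈ a '' S <;> simp [hmu]
    rw [h2, integral_indicator hSa, integral_image_eq_integral_abs_deriv_smul hSm hd hinj]
    refine setIntegral_congr_fun hSm fun x hx => ?_
    simp only [phaseFactor]
    rw [mul_right_comm, ← hG x hx]
    simp only [Complex.real_smul]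
    ring
  simp only [h1]
  rw [lintegral_enorm_exp_integral_sq (hGint.integrable_indicator hSa)]
  congr 1
  have h3 : ∀ mu, ‖(a '' S).indicator G mu‖ₑ ^ 2
      = (a '' S).indicator (fun mu => ‖G mu‖ₑ ^ 2) mu := by
    intro mu
    by_cases hmu : mu ∈ a '' S <;> simp [hmu]
  simp only [h3]
  rw [lintegral_indicator hSa, lintegral_image_eq_lintegral_abs_deriv_mul hSm hd hinj]
  refine setLIntegral_congr_fun hSm fun x hx => ?_
  have hpos := ha.deriv_pos x (hSJ hx)
  simp only [G, hb x hx]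
  rw [enorm_sq_eq_ofReal, enorm_sq_eq_ofReal, ← ENNReal.ofReal_mul (abs_nonneg _),
    ← ENNReal.ofReal_mul (sq_nonneg _)]
  congr 1
  -- Returning to `λ`, the Jacobian `a'` meets the factor `1/a'²` of `|G|²` and leaves `1/a'`.
  rw [norm_div, norm_mul, Complex.norm_real, Complex.norm_real, Real.norm_eq_abs, Real.norm_eq_abs,
    abs_of_pos hpos, div_pow, div_pow (σ x), Real.sq_sqrt hpos.le, mul_pow, sq_abs]
  field_simp

end PhaseFunctions

/-! ### The evolution as a continuous curve in `L²`. -/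

section Propagation

variable {n : ℕ} {E : SpectralMeasure (L2 n)} {J N : Set ℝ} {σ a : ℝ → ℝ}

/-- Absolute continuity makes the behaviour of `a` on `N` irrelevant, and turns Lebesgue
measurability on `B` into measurability for the spectral measure. -/
theorem scalarMeasure_proj_acProj_absolutelyContinuous (E : SpectralMeasure (L2 n)) {B : Set ℝ}
    (hB : MeasurableSet B) (φ : L2 n) :
    E.scalarMeasure (E.proj B (E.acProj φ)) ≪ volume.restrict B := by
  rw [E.scalarMeasure_proj hB]
  exact Measure.AbsolutelyContinuous.restrict (E.acProj_mem φ) B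

theorem evolution_eq {B : Set ℝ} (hB : MeasurableSet B) (φ : L2 n) (t : ℝ) :
    evolution E σ a B φ t = E.apply (phaseFactor σ a t) (E.proj B (E.acProj φ)) := by
  rw [evolution, E.acProj_proj hB]
  rfl

theorem inEvolutionDomain_iff {B : Set ℝ} (hB : MeasurableSet B) (φ : L2 n) :
    InEvolutionDomain E σ B φ
      ↔ MemLp (fun lam => (σ lam : ℂ)) 2 (E.scalarMeasure (E.proj B (E.acProj φ))) := by
  rw [InEvolutionDomain, E.acProj_proj hB]

theorem IsPhase.memLp_phaseFactor (ha : IsPhase J N a) (hσ : ContinuousOn σ J) {B : Set ℝ}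
    (hB : MeasurableSet B) (hBJ : B ⊆ J) {φ : L2 n} (hφ : InEvolutionDomain E σ B φ) (t : ℝ) :
    MemLp (phaseFactor σ a t) 2 (E.scalarMeasure (E.proj B (E.acProj φ))) := by
  refine ((inEvolutionDomain_iff hB φ).mp hφ).of_le
    ((ha.aestronglyMeasurable_phaseFactor hσ hBJ t).mono_ac
      (scalarMeasure_proj_acProj_absolutelyContinuous E hB φ)) (Eventually.of_forall fun lam => ?_)
  rw [norm_phaseFactor, Complex.norm_real, Real.norm_eq_abs]

theorem enorm_phaseFactor (σ a : ℝ → ℝ) (t lam : ℝ) :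
    ‖phaseFactor σ a t lam‖ₑ = ‖(σ lam : ℂ)‖ₑ := by
  rw [← ofReal_norm, norm_phaseFactor, ← ofReal_norm, Complex.norm_real, Real.norm_eq_abs]

theorem enorm_evolution_le {B : Set ℝ} (hB : MeasurableSet B) (φ : L2 n) (t : ℝ) :
    ‖evolution E σ a B φ t‖ₑ
      ≤ eLpNorm (fun lam => (σ lam : ℂ)) 2 (E.scalarMeasure (E.proj B (E.acProj φ))) := by
  rw [evolution_eq hB]
  refine (E.enorm_apply_le _ _).trans (le_of_eq ?_)
  rw [eLpNorm_two_eq_lintegral, eLpNorm_two_eq_lintegral]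
  simp only [enorm_phaseFactor]

theorem IsPhase.continuous_evolution (ha : IsPhase J N a) (hσ : ContinuousOn σ J) {B : Set ℝ}
    (hB : MeasurableSet B) (hBJ : B ⊆ J) {φ : L2 n} (hφ : InEvolutionDomain E σ B φ) :
    Continuous (evolution E σ a B φ) := by
  rw [continuous_iff_continuousAt]
  intro t₀
  set μ := E.scalarMeasure (E.proj B (E.acProj φ)) with hμ
  have hm := ha.memLp_phaseFactor (E := E) hσ hB hBJ hφ
  -- Dominated convergence: the unimodular exponentials differ by at most `2`, and `4|σ|²` is
  -- integrable because `φ` is in the domain.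
  have h1 : Tendsto (fun t => ∫⁻ lam, ‖phaseFactor σ a t lam - phaseFactor σ a t₀ lam‖ₑ ^ 2 ∂μ)
      (𝓝 t₀) (𝓝 (∫⁻ _, 0 ∂μ)) := by
    refine tendsto_lintegral_filter_of_dominated_convergence' (fun lam => (2 * ‖(σ lam : ℂ)‖ₑ) ^ 2)
      (Eventually.of_forall fun t => ((hm t).1.sub (hm t₀).1).enorm.pow_const 2)
      (Eventually.of_forall fun t => Eventually.of_forall fun lam => ?_) ?_
      (Eventually.of_forall fun lam => ?_)
    · gcongr
      rw [two_mul]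
      refine (enorm_sub_le).trans ?_
      rw [enorm_phaseFactor, enorm_phaseFactor]
    · simp only [mul_pow]
      rw [lintegral_const_mul' _ _ (by norm_num)]
      refine ENNReal.mul_ne_top (by norm_num) ?_
      have h2 := ((inEvolutionDomain_iff hB φ).mp hφ).2.ne
      rw [eLpNorm_two_eq_lintegral] at h2
      intro h3
      rw [← hμ, h3] at h2
      simp at h2
    · have h2 : Continuous fun t => phaseFactor σ a t lam := by unfold phaseFactor; fun_prop
      have h3 : Continuous fun t => ‖phaseFactor σ a t lam - phaseFactor σ a t₀ lam‖ₑ ^ 2 := by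
        fun_prop
      simpa using h3.tendsto t₀
  rw [lintegral_zero] at h1
  rw [ContinuousAt, tendsto_iff_edist_tendsto_0]
  have h2 : Tendsto (fun t => (∫⁻ lam, ‖phaseFactor σ a t lam - phaseFactor σ a t₀ lam‖ₑ ^ 2 ∂μ)
      ^ (1 / 2 : ℝ)) (𝓝 t₀) (𝓝 0) := by
    have := h1.ennrpow_const (1 / 2 : ℝ)
    simpa using this
  refine tendsto_of_tendsto_of_tendsto_of_le_of_le tendsto_const_nhds h2 (fun _ => zero_le)
    fun t => ?_
  simp only
  rw [edist_eq_enorm_sub, evolution_eq hB, evolution_eq hB, ← E.apply_sub (hm t) (hm t₀)]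
  refine (E.enorm_apply_le _ _).trans (le_of_eq ?_)
  rw [eLpNorm_two_eq_lintegral]
  rfl

theorem spacetimeNorm_weightedEvolution_sq {s : ℝ} (hs : 0 ≤ s) (B : Set ℝ) (φ : L2 n) :
    spacetimeNorm Set.univ (weightedEvolution E σ a s B φ) ^ 2
      = ∫⁻ t, ‖weightMul hs (evolution E σ a B φ t)‖ₑ ^ 2 := by
  rw [spacetimeNorm_sq, Measure.restrict_univ]
  refine lintegral_congr fun t => ?_
  rw [L2.enorm_sq]
  refine lintegral_congr_ae ?_
  filter_upwards [coeFn_weightMul hs (evolution E σ a B φ t)] with x hx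
  rw [hx]
  rfl

end Propagation

/-! ### The smoothing identity and estimate on the domain. -/

section SmoothingEstimates

variable {n : ℕ} {s : ℝ} {E : SpectralMeasure (L2 n)} {hs : 0 ≤ s} {J N : Set ℝ}
  {A : ℝ → WeightedL2 n s →L[ℂ] WeightedL2 n (-s)} {σ a : ℝ → ℝ}

namespace IsWeakSpectralDerivative

/-- Parseval in `x` decomposes both sides into series over the basis, and Plancherel in `t` matches
them term by term. -/
theorem spacetimeNorm_sq_eq (h : IsWeakSpectralDerivative E hs J A) (ha : IsPhase J N a)
    (hσ : ContinuousOn σ J) {B : Set ℝ} (hB : MeasurableSet B) (hBJ : B ⊆ J) (f : WeightedL2 n s)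
    (hdom : InEvolutionDomain E σ B (f.toL2 hs)) :
    spacetimeNorm Set.univ (weightedEvolution E σ a s B (f.toL2 hs)) ^ 2
      = ENNReal.ofReal (2 * Real.pi) * ∫⁻ lam in B,
          ENNReal.ofReal ((σ lam / Real.sqrt (deriv a lam)) ^ 2) * ‖(A lam f).mulWeight‖ₑ ^ 2 := by
  obtain ⟨ι, _, ⟨b⟩⟩ := exists_countable_hilbertBasis n
  have hu := ha.continuous_evolution hσ hB hBJ hdom
  have hm : AEMeasurable (fun lam => ENNReal.ofReal ((σ lam / Real.sqrt (deriv a lam)) ^ 2))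
      (volume.restrict B) :=
    ((((hσ.aemeasurable h.isOpen.measurableSet).mono_set hBJ).div
      (measurable_deriv a).sqrt.aemeasurable).pow_const 2).ennreal_ofReal
  rw [spacetimeNorm_weightedEvolution_sq hs]
  simp only [← b.tsum_enorm_inner_sq, ← ENNReal.tsum_mul_left, ← weightedPairing_weightedOfL2]
  rw [lintegral_tsum, lintegral_tsum, ← ENNReal.tsum_mul_left]
  · refine tsum_congr fun i => ?_
    -- Only integrability of `σ(λ)(A(λ)f, g)` is kept, from the choice of constant phase; square
    -- integrability is not needed for Plancherel in `[0, ∞]`.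
    have h0 := (h.inner_apply hB hBJ f (weightedOfL2 s (b i)) (F := fun lam => (σ lam : ℂ))
      (Complex.measurable_ofReal.comp_aemeasurable
        ((hσ.aemeasurable h.isOpen.measurableSet).mono_set hBJ)).aestronglyMeasurable
      ((inEvolutionDomain_iff hB _).mp hdom)).1
    rw [← ha.lintegral_oscillatory_integral_sq σ hB hBJ h0]
    refine lintegral_congr fun t => ?_
    rw [← inner_toL2_weightedOfL2, evolution_eq hB, (h.inner_apply hB hBJ f _
      (ha.aestronglyMeasurable_phaseFactor hσ hBJ t) (ha.memLp_phaseFactor hσ hB hBJ hdom t)).2]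
  · intro i
    exact hm.mul ((h.aemeasurable_pairing hBJ f _).enorm.pow_const 2)
  · intro i
    have : Continuous fun t => ‖inner ℂ (b i) (weightMul hs (evolution E σ a B (f.toL2 hs) t))‖ₑ ^ 2 := by
      fun_prop
    exact this.aemeasurable

theorem enorm_mulWeight_sq_le (h : IsWeakSpectralDerivative E hs J A) {lam : ℝ} (hlam : lam ∈ J)
    (f : WeightedL2 n s) : ‖(A lam f).mulWeight‖ₑ ^ 2
      ≤ ENNReal.ofReal (weightedPairing (A lam f) f).re * weightedFormNorm (A lam) := by
  set v := (A lam f).mulWeight with hv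
  rcases eq_or_ne v 0 with h0 | h0
  · simp [h0]
  have hv0 : (‖v‖ : ℂ) ≠ 0 := by exact_mod_cast norm_ne_zero_iff.mpr h0
  -- The extremal test vector for the `L²` norm of `v`: it has norm one in `L²_s` and its pairing
  -- with `A(λ)f` is `‖v‖`.
  let g := weightedOfL2 s ((‖v‖ : ℂ)⁻¹ • v)
  have hg : ‖g‖ = 1 := by
    rw [norm_weightedOfL2, norm_smul, norm_inv, Complex.norm_real, norm_norm,
      inv_mul_cancel₀ (norm_ne_zero_iff.mpr h0)]
  have hfg : weightedPairing (A lam f) g = ‖v‖ := by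
    rw [weightedPairing_weightedOfL2, inner_smul_left, inner_self_eq_norm_sq_to_K, map_inv₀,
      Complex.conj_ofReal]
    simp only [Complex.coe_algebraMap]
    field_simp
  have hcs := h.norm_sq_pairing_le hlam f g
  rw [hfg, Complex.norm_real, norm_norm] at hcs
  rw [← ofReal_norm, ← ENNReal.ofReal_pow (norm_nonneg _)]
  refine (ENNReal.ofReal_le_ofReal hcs).trans ?_
  rw [ENNReal.ofReal_mul (h.pairing_self hlam f).1]
  gcongr
  exact le_iSup₂ (f := fun (ψ : WeightedL2 n s) (_ : ‖ψ‖ = 1) =>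
    ENNReal.ofReal (weightedPairing (A lam ψ) ψ).re) g hg

end IsWeakSpectralDerivative

/-- The supremum of `|σ| a'^{-1/2} ‖A(λ)‖_{s,-s}^{1/2}` over `J \ N`. -/
noncomputable def smoothingBound (J N : Set ℝ) (σ a : ℝ → ℝ)
    (A : ℝ → WeightedL2 n s →L[ℂ] WeightedL2 n (-s)) : ℝ≥0∞ :=
  ⨆ lam ∈ J \ N, ENNReal.ofReal (|σ lam| / Real.sqrt (deriv a lam)) *
    weightedFormNorm (A lam) ^ (1 / 2 : ℝ)

/-- The bound keeps `‖E(B) P_ac f‖²` rather than `‖f‖²`: as a function of `B` it is a measure, as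
the Cauchy argument for the truncations requires. -/
theorem IsWeakSpectralDerivative.spacetimeNorm_sq_le_of_weighted
    (h : IsWeakSpectralDerivative E hs J A) (ha : IsPhase J N a)
    (hσ : ContinuousOn σ J) {B : Set ℝ} (hB : MeasurableSet B) (hBJ : B ⊆ J) (f : WeightedL2 n s)
    (hdom : InEvolutionDomain E σ B (f.toL2 hs)) :
    spacetimeNorm Set.univ (weightedEvolution E σ a s B (f.toL2 hs)) ^ 2
      ≤ ENNReal.ofReal (2 * Real.pi) *
        (smoothingBound J N σ a A ^ 2 * ‖E.proj B (E.acProj (f.toL2 hs))‖ₑ ^ 2) := by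
  have hm : AEMeasurable (fun lam => ENNReal.ofReal (weightedPairing (A lam f) f).re)
      (volume.restrict B) :=
    (Complex.measurable_re.comp_aemeasurable (h.aemeasurable_pairing hBJ f f)).ennreal_ofReal
  rw [h.spacetimeNorm_sq_eq ha hσ hB hBJ f hdom, ← h.lintegral_pairing_self hB hBJ,
    ← lintegral_const_mul'' _ hm, ← ha.restrict_diff B]
  refine mul_le_mul' le_rfl ?_
  refine setLIntegral_mono_ae' (hB.diff ha.finite.measurableSet)
    (Eventually.of_forall fun lam hlam => ?_)
  have hlam' : lam ∈ J \ N := ⟨hBJ hlam.1, hlam.2⟩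
  have h1 : ENNReal.ofReal (|σ lam| / Real.sqrt (deriv a lam)) *
      weightedFormNorm (A lam) ^ (1 / 2 : ℝ) ≤ smoothingBound J N σ a A :=
    le_iSup₂ (f := fun lam (_ : lam ∈ J \ N) => ENNReal.ofReal (|σ lam| / Real.sqrt (deriv a lam)) *
      weightedFormNorm (A lam) ^ (1 / 2 : ℝ)) lam hlam'
  calc ENNReal.ofReal ((σ lam / Real.sqrt (deriv a lam)) ^ 2) * ‖(A lam f).mulWeight‖ₑ ^ 2
      ≤ ENNReal.ofReal ((σ lam / Real.sqrt (deriv a lam)) ^ 2) *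
          (ENNReal.ofReal (weightedPairing (A lam f) f).re * weightedFormNorm (A lam)) := by
        gcongr
        exact h.enorm_mulWeight_sq_le hlam'.1 f
    _ = (ENNReal.ofReal (|σ lam| / Real.sqrt (deriv a lam)) *
          weightedFormNorm (A lam) ^ (1 / 2 : ℝ)) ^ 2 *
            ENNReal.ofReal (weightedPairing (A lam f) f).re := by
        rw [mul_pow, ENNReal.rpow_half_sq, ← ENNReal.ofReal_pow (by positivity), div_pow, div_pow,
          sq_abs]
        ring
    _ ≤ _ := by gcongr

/-- Fatou's lemma in `t`, the integrands converging for every `t`. -/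
theorem lintegral_weightMul_le_of_tendsto (hs : 0 ≤ s) {w : ℕ → ℝ → L2 n} {v : ℝ → L2 n}
    (hw : ∀ k, Continuous (w k)) (hlim : ∀ t, Tendsto (fun k => w k t) atTop (𝓝 (v t)))
    {M : ℕ → ℝ≥0∞} {M' : ℝ≥0∞} (hM : ∀ k, ∫⁻ t, ‖weightMul hs (w k t)‖ₑ ^ 2 ≤ M k)
    (hM' : Tendsto M atTop (𝓝 M')) : ∫⁻ t, ‖weightMul hs (v t)‖ₑ ^ 2 ≤ M' := by
  have h1 : ∀ t, ‖weightMul hs (v t)‖ₑ ^ 2 = liminf (fun k => ‖weightMul hs (w k t)‖ₑ ^ 2) atTop := by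
    intro t
    have hc : Continuous fun u : L2 n => ‖weightMul hs u‖ₑ ^ 2 := by fun_prop
    exact ((hc.tendsto (v t)).comp (hlim t)).liminf_eq.symm
  simp only [h1]
  refine (lintegral_liminf_le fun k => ?_).trans ?_
  · have := hw k
    have hc : Continuous fun t => ‖weightMul hs (w k t)‖ₑ ^ 2 := by fun_prop
    exact hc.measurable
  · rw [← hM'.liminf_eq]
    exact liminf_le_liminf (Eventually.of_forall hM)

theorem IsPhase.aestronglyMeasurable_amplitude (ha : IsPhase J N a) (hσ : ContinuousOn σ J)
    {B : Set ℝ} (hB : MeasurableSet B) (hBJ : B ⊆ J) (φ : L2 n) :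
    AEStronglyMeasurable (fun lam => (σ lam : ℂ))
      (E.scalarMeasure (E.proj B (E.acProj φ))) :=
  (Complex.measurable_ofReal.comp_aemeasurable
    ((hσ.aemeasurable ha.isOpen.measurableSet).mono_set hBJ)).aestronglyMeasurable.mono_ac
      (scalarMeasure_proj_acProj_absolutelyContinuous E hB φ)

theorem eLpNorm_amplitude_le {B : Set ℝ} (hB : MeasurableSet B) {k : ℝ}
    (hk : ∀ lam ∈ B, |σ lam| ≤ k) (φ : L2 n) :
    eLpNorm (fun lam => (σ lam : ℂ)) 2 (E.scalarMeasure (E.proj B (E.acProj φ)))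
      ≤ ENNReal.ofReal k * ‖φ‖ₑ := by
  have h1 : ∫⁻ lam, ‖(σ lam : ℂ)‖ₑ ^ 2 ∂(E.scalarMeasure (E.proj B (E.acProj φ)))
      ≤ ∫⁻ _, ENNReal.ofReal k ^ 2 ∂(E.scalarMeasure (E.proj B (E.acProj φ))) := by
    rw [E.scalarMeasure_proj hB]
    refine setLIntegral_mono_ae' hB (Eventually.of_forall fun lam hlam => ?_)
    gcongr
    rw [← ofReal_norm, Complex.norm_real, Real.norm_eq_abs]
    exact ENNReal.ofReal_le_ofReal (hk lam hlam)
  rw [eLpNorm_two_eq_lintegral, ← ENNReal.sq_rpow_half (ENNReal.ofReal k * ‖φ‖ₑ)]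
  gcongr
  refine h1.trans ?_
  rw [lintegral_const, E.scalarMeasure_apply _ MeasurableSet.univ, mul_pow]
  gcongr
  rw [← ofReal_norm, ← ENNReal.ofReal_pow (norm_nonneg _)]
  refine ENNReal.ofReal_le_ofReal ?_
  gcongr
  exact (E.norm_proj_le MeasurableSet.univ _).trans ((E.norm_proj_le hB _).trans
    (E.norm_acProj_le _))

theorem IsPhase.inEvolutionDomain_of_bounded (ha : IsPhase J N a) (hσ : ContinuousOn σ J)
    {B : Set ℝ} (hB : MeasurableSet B) (hBJ : B ⊆ J) {k : ℝ} (hk : ∀ lam ∈ B, |σ lam| ≤ k)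
    (φ : L2 n) : InEvolutionDomain E σ B φ :=
  (inEvolutionDomain_iff hB φ).mpr ⟨ha.aestronglyMeasurable_amplitude hσ hB hBJ φ,
    (eLpNorm_amplitude_le hB hk φ).trans_lt (ENNReal.mul_lt_top ENNReal.ofReal_lt_top enorm_lt_top)⟩

theorem IsPhase.evolution_sub (ha : IsPhase J N a) (hσ : ContinuousOn σ J)
    {B : Set ℝ} (hB : MeasurableSet B) (hBJ : B ⊆ J) {k : ℝ} (hk : ∀ lam ∈ B, |σ lam| ≤ k)
    (φ ψ : L2 n) (t : ℝ) :
    evolution E σ a B φ t - evolution E σ a B ψ t = evolution E σ a B (φ - ψ) t := by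
  have hm : ∀ χ : L2 n, MemLp (phaseFactor σ a t) 2 (E.scalarMeasure (E.proj B (E.acProj χ))) :=
    fun χ => ha.memLp_phaseFactor hσ hB hBJ (ha.inEvolutionDomain_of_bounded hσ hB hBJ hk χ) t
  have h1 : E.proj B (E.acProj φ) = E.proj B (E.acProj ψ) + E.proj B (E.acProj (φ - ψ)) := by
    rw [← map_add, ← map_add, add_sub_cancel]
  have hφ := hm φ
  rw [sub_eq_iff_eq_add', evolution_eq hB, evolution_eq hB, evolution_eq hB, h1]
  rw [h1] at hφ
  exact E.apply_add_vec (hm ψ) (hm (φ - ψ)) hφ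

theorem IsPhase.evolution_diff (ha : IsPhase J N a) (hσ : ContinuousOn σ J)
    {B C : Set ℝ} (hB : MeasurableSet B) (hC : MeasurableSet C) (hBC : B ⊆ C) (hCJ : C ⊆ J)
    {φ : L2 n} (hφ : InEvolutionDomain E σ C φ) (t : ℝ) :
    evolution E σ a C φ t - evolution E σ a B φ t = evolution E σ a (C \ B) φ t := by
  rw [sub_eq_iff_eq_add', evolution_eq hB, evolution_eq hC, evolution_eq (hC.diff hB)]
  exact E.apply_proj_diff hB hC hBC (ha.memLp_phaseFactor hσ hC hCJ hφ t)

theorem tendsto_setLIntegral_of_antitone {μ : Measure ℝ} {g : ℝ → ℝ≥0∞} {D : ℕ → Set ℝ}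
    (hD : ∀ k, MeasurableSet (D k)) (hanti : Antitone D) (hempty : ⋂ k, D k = ∅)
    (hfin : ∫⁻ x in D 0, g x ∂μ ≠ ∞) :
    Tendsto (fun k => ∫⁻ x in D k, g x ∂μ) atTop (𝓝 0) := by
  have h1 := tendsto_measure_iInter_atTop (μ := μ.withDensity g)
    (fun k => (hD k).nullMeasurableSet) hanti ⟨0, by rwa [withDensity_apply _ (hD 0)]⟩
  rw [hempty, measure_empty] at h1
  exact h1.congr fun k => withDensity_apply _ (hD k)

/-- The part of `B` on which `|σ| ≤ k`. -/
def sublevel (σ : ℝ → ℝ) (B : Set ℝ) (k : ℕ) : Set ℝ := {lam ∈ B | |σ lam| ≤ k}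

theorem sublevel_subset (σ : ℝ → ℝ) (B : Set ℝ) (k : ℕ) : sublevel σ B k ⊆ B := fun _ h => h.1

theorem monotone_sublevel (σ : ℝ → ℝ) (B : Set ℝ) : Monotone (sublevel σ B) :=
  fun _ _ hkm _ h => ⟨h.1, h.2.trans (by exact_mod_cast hkm)⟩

theorem iUnion_sublevel (σ : ℝ → ℝ) (B : Set ℝ) : ⋃ k, sublevel σ B k = B := by
  ext lam
  simp only [Set.mem_iUnion]
  refine ⟨fun ⟨k, hk⟩ => hk.1, fun h => ?_⟩
  obtain ⟨k, hk⟩ := exists_nat_ge |σ lam|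
  exact ⟨k, h, hk⟩

/-- As `σ` is arbitrary outside `J`, the set is written as `B` minus a relatively open, hence open,
subset of `J`. -/
theorem measurableSet_sublevel (hJ : IsOpen J) (hσ : ContinuousOn σ J) {B : Set ℝ}
    (hB : MeasurableSet B) (hBJ : B ⊆ J) (k : ℕ) : MeasurableSet (sublevel σ B k) := by
  have h1 : IsOpen (J ∩ (fun lam => |σ lam|) ⁻¹' Set.Ioi (k : ℝ)) :=
    hσ.abs.isOpen_inter_preimage hJ isOpen_Ioi
  have h2 : sublevel σ B k = B \ (J ∩ (fun lam => |σ lam|) ⁻¹' Set.Ioi (k : ℝ)) := by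
    ext lam
    simp only [sublevel, Set.mem_ofPred_eq, Set.mem_sdiff, Set.mem_inter_iff, Set.mem_preimage,
      Set.mem_Ioi, not_and, not_lt]
    exact ⟨fun h => ⟨h.1, fun _ => h.2⟩, fun h => ⟨h.1, h.2 (hBJ h.1)⟩⟩
  rw [h2]
  exact hB.diff h1.measurableSet

theorem antitone_diff_sublevel (σ : ℝ → ℝ) (B : Set ℝ) : Antitone fun k => B \ sublevel σ B k :=
  fun _ _ hkm => Set.sdiff_subset_sdiff_right (monotone_sublevel σ B hkm)

theorem iInter_diff_sublevel (σ : ℝ → ℝ) (B : Set ℝ) : ⋂ k, B \ sublevel σ B k = ∅ := by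
  rw [← Set.sdiff_iUnion, iUnion_sublevel, Set.sdiff_self]

theorem IsPhase.tendsto_evolution_sublevel (ha : IsPhase J N a) (hσ : ContinuousOn σ J)
    {B : Set ℝ} (hB : MeasurableSet B) (hBJ : B ⊆ J) {φ : L2 n}
    (hφ : InEvolutionDomain E σ B φ) (t : ℝ) :
    Tendsto (fun k => evolution E σ a (sublevel σ B k) φ t) atTop (𝓝 (evolution E σ a B φ t)) := by
  have hm := measurableSet_sublevel ha.isOpen hσ hB hBJ
  have h1 : Tendsto (fun k => ∫⁻ lam in B \ sublevel σ B k, ‖(σ lam : ℂ)‖ₑ ^ 2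
      ∂(E.scalarMeasure (E.acProj φ))) atTop (𝓝 0) := by
    refine tendsto_setLIntegral_of_antitone (fun k => hB.diff (hm k))
      (antitone_diff_sublevel σ B) (iInter_diff_sublevel σ B) ?_
    have h2 := ((inEvolutionDomain_iff hB φ).mp hφ).2.ne
    rw [eLpNorm_two_eq_lintegral, E.scalarMeasure_proj hB] at h2
    refine ne_top_of_le_ne_top ?_ (lintegral_mono_set Set.sdiff_subset)
    intro h3
    rw [h3] at h2
    simp at h2
  rw [tendsto_iff_edist_tendsto_0]
  have h2 := h1.ennrpow_const (1 / 2 : ℝ)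
  rw [ENNReal.zero_rpow_of_pos (by norm_num)] at h2
  refine tendsto_of_tendsto_of_tendsto_of_le_of_le tendsto_const_nhds h2 (fun _ => zero_le)
    fun k => ?_
  simp only
  rw [edist_comm, edist_eq_enorm_sub, ha.evolution_diff hσ (hm k) hB (sublevel_subset σ B k) hBJ hφ]
  refine (enorm_evolution_le (hB.diff (hm k)) φ t).trans (le_of_eq ?_)
  rw [eLpNorm_two_eq_lintegral, E.scalarMeasure_proj (hB.diff (hm k))]

/-- Fatou is used twice: with `σ` bounded by `k`, to pass from `L²_s` to `L²` by density, and then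
as `k → ∞`. Finiteness of the bound makes the right-hand side continuous in `φ`. -/
theorem IsWeakSpectralDerivative.spacetimeNorm_sq_le
    (h : IsWeakSpectralDerivative E hs J A) (ha : IsPhase J N a)
    (hσ : ContinuousOn σ J) (hC : smoothingBound J N σ a A ≠ ∞) {B : Set ℝ} (hB : MeasurableSet B)
    (hBJ : B ⊆ J) {φ : L2 n} (hdom : InEvolutionDomain E σ B φ) :
    spacetimeNorm Set.univ (weightedEvolution E σ a s B φ) ^ 2
      ≤ ENNReal.ofReal (2 * Real.pi) *
        (smoothingBound J N σ a A ^ 2 * ‖E.proj B (E.acProj φ)‖ₑ ^ 2) := by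
  have hm := measurableSet_sublevel ha.isOpen hσ hB hBJ
  have hsub : ∀ k, sublevel σ B k ⊆ J := fun k => (sublevel_subset σ B k).trans hBJ
  have hle : ∀ k, ∀ lam ∈ sublevel σ B k, |σ lam| ≤ k := fun k lam hlam => hlam.2
  have hbdd := fun k (χ : L2 n) =>
    ha.inEvolutionDomain_of_bounded (E := E) hσ (hm k) (hsub k) (hle k) χ
  have hconst : Continuous fun c : ℝ≥0∞ => ENNReal.ofReal (2 * Real.pi) *
      (smoothingBound J N σ a A ^ 2 * c) :=
    (ENNReal.continuous_const_mul ENNReal.ofReal_ne_top).comp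
      (ENNReal.continuous_const_mul (ENNReal.pow_ne_top hC))
  have hlim : ∀ C : Set ℝ, Continuous fun χ : L2 n => ‖E.proj C (E.acProj χ)‖ₑ ^ 2 := fun C => by
    fun_prop
  have step : ∀ k, spacetimeNorm Set.univ (weightedEvolution E σ a s (sublevel σ B k) φ) ^ 2
      ≤ ENNReal.ofReal (2 * Real.pi) *
        (smoothingBound J N σ a A ^ 2 * ‖E.proj (sublevel σ B k) (E.acProj φ)‖ₑ ^ 2) := by
    intro k
    obtain ⟨f, hf⟩ : ∃ f : ℕ → WeightedL2 n s, Tendsto (fun j => (f j).toL2 hs) atTop (𝓝 φ) := by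
      obtain ⟨x, hx, hxφ⟩ := mem_closure_iff_seq_limit.mp ((WeightedL2.denseRange_toL2 hs) φ)
      choose f hf using hx
      exact ⟨f, by simpa only [hf] using hxφ⟩
    rw [spacetimeNorm_weightedEvolution_sq hs]
    refine lintegral_weightMul_le_of_tendsto hs
      (w := fun j => evolution E σ a (sublevel σ B k) ((f j).toL2 hs))
      (M := fun j => ENNReal.ofReal (2 * Real.pi) * (smoothingBound J N σ a A ^ 2 *
        ‖E.proj (sublevel σ B k) (E.acProj ((f j).toL2 hs))‖ₑ ^ 2))
      (fun j => ha.continuous_evolution hσ (hm k) (hsub k) (hbdd k _)) (fun t => ?_) (fun j => ?_)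
      ((hconst.tendsto _).comp (((hlim _).tendsto φ).comp hf))
    · rw [tendsto_iff_edist_tendsto_0]
      -- On `{|σ| ≤ k}` the evolution is `k`-Lipschitz in the initial vector.
      have h2 : Tendsto (fun j => ENNReal.ofReal k * edist ((f j).toL2 hs) φ) atTop (𝓝 0) := by
        simpa using ENNReal.Tendsto.const_mul (tendsto_iff_edist_tendsto_0.mp hf)
          (Or.inr (ENNReal.ofReal_ne_top (r := k)))
      refine tendsto_of_tendsto_of_tendsto_of_le_of_le tendsto_const_nhds h2 (fun _ => zero_le)
        fun j => ?_
      simp only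
      rw [edist_eq_enorm_sub, edist_eq_enorm_sub, ha.evolution_sub hσ (hm k) (hsub k) (hle k)]
      exact (enorm_evolution_le (hm k) _ t).trans (eLpNorm_amplitude_le (hm k) (hle k) _)
    · rw [← spacetimeNorm_weightedEvolution_sq hs]
      exact h.spacetimeNorm_sq_le_of_weighted ha hσ (hm k) (hsub k) (f j) (hbdd k _)
  rw [spacetimeNorm_weightedEvolution_sq hs]
  refine lintegral_weightMul_le_of_tendsto hs
    (fun k => ha.continuous_evolution hσ (hm k) (hsub k) (hbdd k φ))
    (fun t => ha.tendsto_evolution_sublevel hσ hB hBJ hdom t)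
    (M := fun _ => ENNReal.ofReal (2 * Real.pi) *
        (smoothingBound J N σ a A ^ 2 * ‖E.proj B (E.acProj φ)‖ₑ ^ 2)) (fun k => ?_)
    tendsto_const_nhds
  rw [← spacetimeNorm_weightedEvolution_sq hs]
  refine (step k).trans ?_
  gcongr
  have h3 : E.proj (sublevel σ B k) (E.acProj φ)
      = E.proj (sublevel σ B k) (E.proj B (E.acProj φ)) := by
    rw [E.proj_proj (hm k) hB, Set.inter_eq_left.mpr (sublevel_subset σ B k)]
  rw [h3, ← ofReal_norm, ← ofReal_norm]
  exact ENNReal.ofReal_le_ofReal (E.norm_proj_le (hm k) _)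

end SmoothingEstimates

/-! ### Truncation of `σ` and arbitrary initial vectors. -/

section Truncation

variable {n : ℕ} {s : ℝ} {E : SpectralMeasure (L2 n)} {hs : 0 ≤ s} {J N : Set ℝ}
  {A : ℝ → WeightedL2 n s →L[ℂ] WeightedL2 n (-s)} {σ a : ℝ → ℝ}

theorem exists_tendsto_eLpNorm_of_cauchy {α : Type*} [MeasurableSpace α] {μ : Measure α}
    {W : ℕ → α → ℂ} (hW : ∀ k, MemLp (W k) 2 μ) {b : ℕ → ℝ≥0∞} (hb : Tendsto b atTop (𝓝 0))
    (h : ∀ k m, k ≤ m → eLpNorm (W m - W k) 2 μ ≤ b k) :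
    ∃ U, MemLp U 2 μ ∧ Tendsto (fun k => eLpNorm (W k - U) 2 μ) atTop (𝓝 0) := by
  let w : ℕ → Lp ℂ 2 μ := fun k => (hW k).toLp (W k)
  have hdist : ∀ k m, edist (w m) (w k) = eLpNorm (W m - W k) 2 μ := fun k m =>
    Lp.edist_toLp_toLp _ _ (hW m) (hW k)
  have hcau : CauchySeq w := by
    rw [EMetric.cauchySeq_iff]
    intro ε hε
    have hε2 : 0 < ε / 2 := ENNReal.half_pos hε.ne'
    obtain ⟨K, hK⟩ := (hb.eventually (gt_mem_nhds hε2)).exists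
    refine ⟨K, fun p hp q hq => ?_⟩
    have hle : ∀ m, K ≤ m → edist (w m) (w K) < ε / 2 := fun m hm =>
      ((hdist K m).trans_le (h K m hm)).trans_lt hK
    calc edist (w p) (w q) ≤ edist (w p) (w K) + edist (w q) (w K) := edist_triangle_right _ _ _
      _ < ε / 2 + ε / 2 := ENNReal.add_lt_add (hle p hp) (hle q hq)
      _ = ε := ENNReal.add_halves ε
  obtain ⟨U, hU⟩ := cauchySeq_tendsto_of_complete hcau
  refine ⟨U, Lp.memLp U, ?_⟩
  refine (tendsto_iff_edist_tendsto_0.mp hU).congr fun k => ?_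
  rw [Lp.edist_def]
  refine eLpNorm_congr_ae ?_
  filter_upwards [(hW k).coeFn_toLp] with x hx
  simp only [Pi.sub_apply]
  rw [hx]

theorem tendsto_eLpNorm_of_tendsto_sub {α : Type*} [MeasurableSpace α] {μ : Measure α}
    {W : ℕ → α → ℂ} {U : α → ℂ} (hW : ∀ k, AEStronglyMeasurable (W k) μ)
    (hU : AEStronglyMeasurable U μ)
    (h : Tendsto (fun k => eLpNorm (W k - U) 2 μ) atTop (𝓝 0)) :
    Tendsto (fun k => eLpNorm (W k) 2 μ) atTop (𝓝 (eLpNorm U 2 μ)) := by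
  rcases eq_or_ne (eLpNorm U 2 μ) ∞ with htop | htop
  · have h1 : ∀ᶠ k in atTop, eLpNorm (W k) 2 μ = ∞ := by
      filter_upwards [h.eventually (gt_mem_nhds zero_lt_one)] with k hk
      by_contra hne
      have h2 : eLpNorm U 2 μ ≤ eLpNorm (W k) 2 μ + eLpNorm (W k - U) 2 μ := by
        have h3 : U = W k - (W k - U) := by abel
        conv_lhs => rw [h3]
        exact eLpNorm_sub_le (hW k) ((hW k).sub hU) (by norm_num)
      rw [htop, top_le_iff, ENNReal.add_eq_top] at h2
      exact h2.elim hne fun h3 => by simp [h3] at hk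
    rw [htop]
    exact tendsto_const_nhds.congr' (h1.mono fun k hk => hk.symm)
  · refine tendsto_of_tendsto_of_tendsto_of_le_of_le
      (g := fun k => eLpNorm U 2 μ - eLpNorm (W k - U) 2 μ)
      (h := fun k => eLpNorm U 2 μ + eLpNorm (W k - U) 2 μ) ?_ ?_ (fun k => ?_) (fun k => ?_)
    · simpa using ENNReal.Tendsto.sub tendsto_const_nhds h (Or.inl htop)
    · simpa using tendsto_const_nhds.add h
    · rw [tsub_le_iff_right]
      have h3 : U = W k - (W k - U) := by abel
      conv_lhs => rw [h3]
      exact eLpNorm_sub_le (hW k) ((hW k).sub hU) (by norm_num)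
    · have h3 : W k = U + (W k - U) := by abel
      conv_lhs => rw [h3]
      exact eLpNorm_add_le hU ((hW k).sub hU) (by norm_num)

/-- The evolution is represented by a jointly measurable function on space-time. -/
theorem IsPhase.exists_joint_weightedEvolution (ha : IsPhase J N a) (hs : 0 ≤ s)
    (hσ : ContinuousOn σ J) {B : Set ℝ} (hB : MeasurableSet B) (hBJ : B ⊆ J) {φ : L2 n}
    (hφ : InEvolutionDomain E σ B φ) :
    ∃ W : ℝ × EuclideanSpace ℝ (Fin n) → ℂ, StronglyMeasurable W ∧
      ∀ t, (fun x => W (t, x)) =ᵐ[volume] weightedEvolution E σ a s B φ t := by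
  obtain ⟨W, hW, hW'⟩ := exists_stronglyMeasurable_joint_version
    ((weightMul hs).continuous.comp (ha.continuous_evolution (E := E) hσ hB hBJ hφ))
  exact ⟨W, hW, fun t => (hW' t).trans (coeFn_weightMul hs _)⟩

theorem weightedEvolution_sub_ae {B C : Set ℝ} (hB : MeasurableSet B) (hC : MeasurableSet C)
    (ha : IsPhase J N a) (hσ : ContinuousOn σ J) (hBC : B ⊆ C) (hCJ : C ⊆ J) {φ : L2 n}
    (hφ : InEvolutionDomain E σ C φ) (t : ℝ) :
    (fun x => weightedEvolution E σ a s C φ t x - weightedEvolution E σ a s B φ t x)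
      =ᵐ[volume] weightedEvolution E σ a s (C \ B) φ t := by
  filter_upwards [Lp.coeFn_sub (evolution E σ a C φ t) (evolution E σ a B φ t)] with x hx
  rw [ha.evolution_diff hσ hB hC hBC hCJ hφ, Pi.sub_apply] at hx
  simp only [weightedEvolution, hx]
  ring

/-- Every limit `U` has its norm fixed by the truncations, so the infimum defining
`weightedEvolutionNorm` is taken over a single value. -/
theorem IsPhase.tendsto_spacetimeNorm_of_isWeightedEvolution (ha : IsPhase J N a) (hs : 0 ≤ s)
    (hσ : ContinuousOn σ J) {φ : L2 n} {U : ℝ × EuclideanSpace ℝ (Fin n) → ℂ}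
    (hU : IsWeightedEvolution E σ a s J φ U) :
    Tendsto (fun k => spacetimeNorm Set.univ (weightedEvolution E σ a s (sublevel σ J k) φ)) atTop
      (𝓝 (eLpNorm U 2 volume)) := by
  have hm := measurableSet_sublevel ha.isOpen hσ ha.isOpen.measurableSet subset_rfl
  choose W hW hW' using fun k => ha.exists_joint_weightedEvolution (E := E) hs hσ (hm k)
    (sublevel_subset σ J k) (ha.inEvolutionDomain_of_bounded hσ (hm k) (sublevel_subset σ J k)
      (fun lam hlam => hlam.2) φ)
  have h1 := tendsto_eLpNorm_of_tendsto_sub (μ := volume) (U := U)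
    (fun k => (hW k).aestronglyMeasurable) hU.1.1 ?_
  · refine h1.congr fun k => ?_
    rw [eLpNorm_eq_spacetimeNorm (hW k).aestronglyMeasurable]
    exact spacetimeNorm_congr (hW' k)
  · refine hU.2.congr fun k => ?_
    rw [eLpNorm_eq_spacetimeNorm ((hW k).aestronglyMeasurable.sub hU.1.1)]
    refine spacetimeNorm_congr fun t => ?_
    filter_upwards [hW' k t] with x hx
    rw [Pi.sub_apply, hx]
    rfl

/-- The difference of two truncations is the evolution localized to the difference of the sublevel
sets, so its norm is bounded by a tail of a finite measure and completeness of `L²` applies. The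
pair `μ`, `g` is free because (i) uses Lebesgue measure with a density and (ii) the scalar spectral
measure with a constant. -/
theorem IsPhase.exists_isWeightedEvolution (ha : IsPhase J N a) (hs : 0 ≤ s)
    (hσ : ContinuousOn σ J) {φ : L2 n} {μ : Measure ℝ} {g : ℝ → ℝ≥0∞}
    (hfin : ∫⁻ lam in J, g lam ∂μ ≠ ∞)
    (hbound : ∀ B, MeasurableSet B → B ⊆ J → InEvolutionDomain E σ B φ →
      spacetimeNorm Set.univ (weightedEvolution E σ a s B φ) ^ 2 ≤ ∫⁻ lam in B, g lam ∂μ) :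
    ∃ U, IsWeightedEvolution E σ a s J φ U := by
  have hm := measurableSet_sublevel ha.isOpen hσ ha.isOpen.measurableSet subset_rfl
  have hdom : ∀ k, ∀ B, MeasurableSet B → B ⊆ sublevel σ J k → InEvolutionDomain E σ B φ :=
    fun k B hB hBk => ha.inEvolutionDomain_of_bounded hσ hB (hBk.trans (sublevel_subset σ J k))
      (k := k) (fun lam hlam => (hBk hlam).2) φ
  choose W hW hW' using fun k => ha.exists_joint_weightedEvolution (E := E) hs hσ (hm k)
    (sublevel_subset σ J k) (hdom k _ (hm k) subset_rfl)
  have hWmem : ∀ k, MemLp (W k) 2 volume := by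
    intro k
    refine ⟨(hW k).aestronglyMeasurable, ?_⟩
    rw [eLpNorm_eq_spacetimeNorm (hW k).aestronglyMeasurable, spacetimeNorm_congr (hW' k)]
    have h1 := (hbound _ (hm k) (sublevel_subset σ J k) (hdom k _ (hm k) subset_rfl)).trans_lt
      ((lintegral_mono_set (sublevel_subset σ J k)).trans_lt hfin.lt_top)
    exact (ENNReal.pow_lt_top_iff.mp h1).resolve_right two_ne_zero
  have hb : Tendsto (fun k => (∫⁻ lam in J \ sublevel σ J k, g lam ∂μ) ^ (1 / 2 : ℝ)) atTop (𝓝 0) := by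
    have h1 := (tendsto_setLIntegral_of_antitone (μ := μ) (g := g)
      (fun k => ha.isOpen.measurableSet.diff (hm k)) (antitone_diff_sublevel σ J)
      (iInter_diff_sublevel σ J)
      (ne_top_of_le_ne_top hfin (lintegral_mono_set Set.sdiff_subset))).ennrpow_const (1 / 2 : ℝ)
    rwa [ENNReal.zero_rpow_of_pos (by norm_num)] at h1
  obtain ⟨U, hU, hlim⟩ := exists_tendsto_eLpNorm_of_cauchy hWmem hb (fun k m hkm => by
    have hsub := monotone_sublevel σ J hkm
    have hmk := (hm m).diff (hm k)
    rw [eLpNorm_eq_spacetimeNorm ((hW m).sub (hW k)).aestronglyMeasurable]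
    have h1 : spacetimeNorm Set.univ (fun t x => (W m - W k) (t, x))
        = spacetimeNorm Set.univ
            (weightedEvolution E σ a s (sublevel σ J m \ sublevel σ J k) φ) := by
      refine spacetimeNorm_congr fun t => ?_
      filter_upwards [hW' m t, hW' k t, weightedEvolution_sub_ae (E := E) (s := s) (hm k) (hm m) ha
        hσ hsub (sublevel_subset σ J m) (hdom m _ (hm m) subset_rfl) t] with x h2 h3 h4
      rw [Pi.sub_apply, h2, h3, ← h4]
    rw [h1, ← ENNReal.sq_rpow_half (spacetimeNorm _ _)]
    gcongr
    refine (hbound _ hmk (Set.sdiff_subset.trans (sublevel_subset σ J m))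
      (hdom m _ hmk Set.sdiff_subset)).trans (lintegral_mono_set ?_)
    exact Set.sdiff_subset_sdiff_left (sublevel_subset σ J m))
  refine ⟨U, hU, hlim.congr fun k => ?_⟩
  rw [eLpNorm_eq_spacetimeNorm ((hW k).aestronglyMeasurable.sub hU.1)]
  refine spacetimeNorm_congr fun t => ?_
  filter_upwards [hW' k t] with x hx
  rw [Pi.sub_apply, hx]
  rfl

theorem evolution_zero {B : Set ℝ} (hB : MeasurableSet B) (t : ℝ) :
    evolution E σ a B (0 : L2 n) t = 0 := by
  rw [← enorm_eq_zero, ← nonpos_iff_eq_zero]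
  refine (enorm_evolution_le hB _ t).trans ?_
  have h0 : E.scalarMeasure (E.proj B (E.acProj (0 : L2 n))) = 0 := by
    ext C hC
    rw [E.scalarMeasure_apply _ hC]
    simp
  rw [h0]
  simp

namespace IsWeakSpectralDerivative

theorem spacetimeNorm_spectral_sq (f : WeightedL2 n s) (B : Set ℝ) :
    spacetimeNorm B (fun lam x =>
        ((σ lam / Real.sqrt (deriv a lam) * japaneseBracket x ^ (-s) : ℝ) : ℂ) * A lam f x) ^ 2
      = ∫⁻ lam in B, ENNReal.ofReal ((σ lam / Real.sqrt (deriv a lam)) ^ 2)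
          * ‖(A lam f).mulWeight‖ₑ ^ 2 := by
  rw [spacetimeNorm_sq]
  exact lintegral_congr fun lam => (A lam f).lintegral_mulWeight _

theorem sqrt_two_pi_mul_sq (c : ℝ≥0∞) :
    (ENNReal.ofReal (Real.sqrt (2 * Real.pi)) * c) ^ 2 = ENNReal.ofReal (2 * Real.pi) * c ^ 2 := by
  rw [mul_pow, ← ENNReal.ofReal_pow (Real.sqrt_nonneg _), Real.sq_sqrt (by positivity)]

theorem spacetimeNorm_eq (h : IsWeakSpectralDerivative E hs J A) (ha : IsPhase J N a)
    (hσ : ContinuousOn σ J) {B : Set ℝ} (hB : MeasurableSet B) (hBJ : B ⊆ J) (f : WeightedL2 n s)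
    (hdom : InEvolutionDomain E σ B (f.toL2 hs)) :
    spacetimeNorm Set.univ (weightedEvolution E σ a s B (f.toL2 hs))
      = ENNReal.ofReal (Real.sqrt (2 * Real.pi)) * spacetimeNorm B (fun lam x =>
        ((σ lam / Real.sqrt (deriv a lam) * japaneseBracket x ^ (-s) : ℝ) : ℂ) * A lam f x) := by
  refine (ENNReal.pow_right_strictMono two_ne_zero).injective ?_
  rw [sqrt_two_pi_mul_sq, spacetimeNorm_spectral_sq, h.spacetimeNorm_sq_eq ha hσ hB hBJ f hdom]

theorem weightedEvolutionNorm_eq (h : IsWeakSpectralDerivative E hs J A) (ha : IsPhase J N a)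
    (hσ : ContinuousOn σ J) (f : WeightedL2 n s) :
    weightedEvolutionNorm E σ a s J (f.toL2 hs)
      = ENNReal.ofReal (Real.sqrt (2 * Real.pi)) * spacetimeNorm J (fun lam x =>
        ((σ lam / Real.sqrt (deriv a lam) * japaneseBracket x ^ (-s) : ℝ) : ℂ) * A lam f x) := by
  set R := ENNReal.ofReal (Real.sqrt (2 * Real.pi)) * spacetimeNorm J (fun lam x =>
        ((σ lam / Real.sqrt (deriv a lam) * japaneseBracket x ^ (-s) : ℝ) : ℂ) * A lam f x) with hR
  let g : ℝ → ℝ≥0∞ := fun lam => ENNReal.ofReal ((σ lam / Real.sqrt (deriv a lam)) ^ 2)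
          * ‖(A lam f).mulWeight‖ₑ ^ 2
  have hm := measurableSet_sublevel ha.isOpen hσ ha.isOpen.measurableSet subset_rfl
  have hsq : ∀ B, MeasurableSet B → B ⊆ J → InEvolutionDomain E σ B (f.toL2 hs) →
      spacetimeNorm Set.univ (weightedEvolution E σ a s B (f.toL2 hs)) ^ 2
        = ∫⁻ lam in B, ENNReal.ofReal (2 * Real.pi) * g lam := by
    intro B hB hBJ hdom
    rw [h.spacetimeNorm_sq_eq ha hσ hB hBJ f hdom, lintegral_const_mul' _ _ ENNReal.ofReal_ne_top]
  have hRsq : R ^ 2 = ∫⁻ lam in J, ENNReal.ofReal (2 * Real.pi) * g lam := by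
    rw [hR, sqrt_two_pi_mul_sq, spacetimeNorm_spectral_sq,
      lintegral_const_mul' _ _ ENNReal.ofReal_ne_top]
  have huniq : ∀ U, IsWeightedEvolution E σ a s J (f.toL2 hs) U → eLpNorm U 2 volume = R := by
    intro U hU
    have h1 := ((ENNReal.continuous_pow 2).tendsto _).comp
      (ha.tendsto_spacetimeNorm_of_isWeightedEvolution hs hσ hU)
    have h2 : Tendsto (fun k => ∫⁻ lam in sublevel σ J k, ENNReal.ofReal (2 * Real.pi) * g lam) atTop
        (𝓝 (R ^ 2)) := by
      rw [hRsq]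
      have h3 := tendsto_measure_iUnion_atTop
        (μ := volume.withDensity fun lam => ENNReal.ofReal (2 * Real.pi) * g lam)
        (monotone_sublevel σ J)
      rw [iUnion_sublevel, withDensity_apply _ ha.isOpen.measurableSet] at h3
      exact h3.congr fun k => withDensity_apply _ (hm k)
    have h3 := tendsto_nhds_unique (h1.congr fun k => hsq _ (hm k) (sublevel_subset σ J k)
      (ha.inEvolutionDomain_of_bounded hσ (hm k) (sublevel_subset σ J k)
        (fun lam hlam => hlam.2) _)) h2
    exact (ENNReal.pow_right_strictMono two_ne_zero).injective h3
  by_cases hex : ∃ U, IsWeightedEvolution E σ a s J (f.toL2 hs) U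
  · obtain ⟨U, hU⟩ := hex
    refine le_antisymm ((iInf₂_le U hU).trans (huniq U hU).le) (le_iInf₂ fun V hV => ?_)
    exact (huniq V hV).ge
  -- A finite `R` would make the truncations converge; without a limit, `R` and the infimum over the
  -- empty family are both `∞`.
  · have hRtop : R = ∞ := by
      by_contra hne
      refine hex (ha.exists_isWeightedEvolution hs hσ (μ := volume)
        (g := fun lam => ENNReal.ofReal (2 * Real.pi) * g lam) ?_
        fun B hB hBJ hdom => (hsq B hB hBJ hdom).le)
      rw [← hRsq]
      exact ENNReal.pow_ne_top hne
    rw [hRtop, weightedEvolutionNorm, iInf₂_eq_top]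
    exact fun U hU => absurd ⟨U, hU⟩ hex

theorem spacetimeNorm_le (h : IsWeakSpectralDerivative E hs J A) (ha : IsPhase J N a)
    (hσ : ContinuousOn σ J) {B : Set ℝ} (hB : MeasurableSet B) (hBJ : B ⊆ J) {φ : L2 n}
    (hdom : InEvolutionDomain E σ B φ) :
    spacetimeNorm Set.univ (weightedEvolution E σ a s B φ)
      ≤ ENNReal.ofReal (Real.sqrt (2 * Real.pi)) * smoothingBound J N σ a A * ‖φ‖ₑ := by
  rw [mul_assoc, ← ENNReal.pow_le_pow_left_iff two_ne_zero, sqrt_two_pi_mul_sq, mul_pow]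
  -- The zero vector is separated because `∞ * 0 = 0`: with an infinite bound the right-hand side is
  -- then `0`, and the evolution has to vanish.
  rcases eq_or_ne φ 0 with rfl | hφ
  · rw [spacetimeNorm_weightedEvolution_sq hs]
    simp [evolution_zero hB]
  rcases eq_or_ne (smoothingBound J N σ a A) ∞ with hC | hC
  · rw [hC, ENNReal.top_pow two_ne_zero, ENNReal.top_mul (by simpa using hφ), ENNReal.mul_top]
    · exact le_top
    · simpa using Real.pi_pos
  · refine (h.spacetimeNorm_sq_le ha hσ hC hB hBJ hdom).trans ?_
    gcongr
    rw [← ofReal_norm, ← ofReal_norm φ]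
    exact ENNReal.ofReal_le_ofReal ((E.norm_proj_le hB _).trans (E.norm_acProj_le _))

theorem weightedEvolutionNorm_le (h : IsWeakSpectralDerivative E hs J A) (ha : IsPhase J N a)
    (hσ : ContinuousOn σ J) (φ : L2 n) :
    weightedEvolutionNorm E σ a s J φ
      ≤ ENNReal.ofReal (Real.sqrt (2 * Real.pi)) * smoothingBound J N σ a A * ‖φ‖ₑ := by
  have hm := measurableSet_sublevel ha.isOpen hσ ha.isOpen.measurableSet subset_rfl
  have hdom := fun k => ha.inEvolutionDomain_of_bounded (E := E) hσ (hm k) (sublevel_subset σ J k)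
      (fun lam hlam => hlam.2) φ
  have key : ∀ U, IsWeightedEvolution E σ a s J φ U → weightedEvolutionNorm E σ a s J φ
      ≤ ENNReal.ofReal (Real.sqrt (2 * Real.pi)) * smoothingBound J N σ a A * ‖φ‖ₑ := by
    intro U hU
    exact (iInf₂_le U hU).trans (le_of_tendsto'
      (ha.tendsto_spacetimeNorm_of_isWeightedEvolution hs hσ hU)
      fun k => h.spacetimeNorm_le ha hσ (hm k) (sublevel_subset σ J k) (hdom k))
  -- An upper bound on `weightedEvolutionNorm` requires a limit to exist, unless the right-hand side
  -- is `∞`; for `φ = 0` the truncations vanish and a limit exists whatever the bound.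
  rcases eq_or_ne φ 0 with rfl | hφ
  · obtain ⟨U, hU⟩ := ha.exists_isWeightedEvolution (E := E) (s := s) (φ := 0) hs hσ
      (μ := volume) (g := 0) (by simp) (fun B hB _ _ => by
        rw [spacetimeNorm_weightedEvolution_sq hs]
        simp [evolution_zero hB])
    exact key U hU
  rcases eq_or_ne (smoothingBound J N σ a A) ∞ with hC | hC
  · rw [hC, ENNReal.mul_top (by simpa using Real.pi_pos), ENNReal.top_mul (by simpa using hφ)]
    exact le_top
  · obtain ⟨U, hU⟩ := ha.exists_isWeightedEvolution (E := E) (s := s) (φ := φ) hs hσ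
      (μ := E.scalarMeasure (E.acProj φ))
      (g := fun _ => ENNReal.ofReal (2 * Real.pi) * smoothingBound J N σ a A ^ 2)
      (by
        rw [setLIntegral_const]
        exact ENNReal.mul_ne_top (ENNReal.mul_ne_top ENNReal.ofReal_ne_top
          (ENNReal.pow_ne_top hC)) (measure_ne_top _ _))
      (fun B hB hBJ hB' => by
        refine (h.spacetimeNorm_sq_le ha hσ hC hB hBJ hB').trans (le_of_eq ?_)
        rw [setLIntegral_const, E.scalarMeasure_apply _ hB, ENNReal.ofReal_pow (norm_nonneg _),
          ofReal_norm, mul_assoc])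
    exact key U hU

end IsWeakSpectralDerivative

end Truncation

theorem mainTheorem10 (n : ℕ) (s : ℝ) (hs : 0 < s)
    -- a self-adjoint operator and its spectral measure
    (H : L2 n →ₗ.[ℂ] L2 n) (hH : IsSelfAdjoint H)
    (E : SpectralMeasure (L2 n)) (hE : E.IsSpectralMeasureOf H)
    -- the weak spectral derivative on the open set `J`
    (J : Set ℝ) (hJ : IsOpen J)
    (A : ℝ → WeightedL2 n s →L[ℂ] WeightedL2 n (-s))
    (hA : ∀ lam ∈ J, ∀ f g : WeightedL2 n s,
      HasDerivAt (fun mu : ℝ =>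
          inner ℂ (g.toL2 hs.le) (E.proj (Set.Iio mu) (E.acProj (f.toL2 hs.le))))
        (weightedPairing (A lam f) g) lam)
    (hAcont : ∀ f g : WeightedL2 n s, ContinuousOn (fun lam => weightedPairing (A lam f) g) J)
    -- the functions `σ` and `a`
    (σ a : ℝ → ℝ) (hσ : ContinuousOn σ J)
    (N : Set ℝ) (hN : N.Finite) (hNJ : N ⊆ J)
    (ha : ContDiffOn ℝ 1 a (J \ N)) (ha' : ∀ lam ∈ J \ N, 0 < deriv a lam)
    (hinj : Set.InjOn a (J \ N)) :
    -- the identity, for `φ ∈ L²_s`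
    (∀ φ : WeightedL2 n s,
      (InEvolutionDomain E σ J (φ.toL2 hs.le) →
        spacetimeNorm Set.univ (weightedEvolution E σ a s J (φ.toL2 hs.le))
          = ENNReal.ofReal (Real.sqrt (2 * Real.pi)) *
            spacetimeNorm J (fun lam x =>
              ((σ lam / Real.sqrt (deriv a lam) * japaneseBracket x ^ (-s) : ℝ) : ℂ)
                * A lam φ x)) ∧
      weightedEvolutionNorm E σ a s J (φ.toL2 hs.le)
        = ENNReal.ofReal (Real.sqrt (2 * Real.pi)) *
          spacetimeNorm J (fun lam x =>
            ((σ lam / Real.sqrt (deriv a lam) * japaneseBracket x ^ (-s) : ℝ) : ℂ)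
              * A lam φ x)) ∧
    -- the estimate, for `φ ∈ L²`
    (∀ φ : L2 n,
      (InEvolutionDomain E σ J φ →
        spacetimeNorm Set.univ (weightedEvolution E σ a s J φ)
          ≤ ENNReal.ofReal (Real.sqrt (2 * Real.pi)) *
            (⨆ lam ∈ J \ N, ENNReal.ofReal (|σ lam| / Real.sqrt (deriv a lam)) *
              weightedFormNorm (A lam) ^ (1 / 2 : ℝ)) * ‖φ‖ₑ) ∧
      weightedEvolutionNorm E σ a s J φ
        ≤ ENNReal.ofReal (Real.sqrt (2 * Real.pi)) *
          (⨆ lam ∈ J \ N, ENNReal.ofReal (|σ lam| / Real.sqrt (deriv a lam)) *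
            weightedFormNorm (A lam) ^ (1 / 2 : ℝ)) * ‖φ‖ₑ) := by
  have h : IsWeakSpectralDerivative E hs.le J A := ⟨hJ, hA, hAcont⟩
  have hp : IsPhase J N a := ⟨hJ, hN, ha, ha', hinj⟩
  exact ⟨fun φ => ⟨fun hφ => h.spacetimeNorm_eq hp hσ hJ.measurableSet subset_rfl φ hφ,
      h.weightedEvolutionNorm_eq hp hσ φ⟩,
    fun φ => ⟨fun hφ => h.spacetimeNorm_le hp hσ hJ.measurableSet subset_rfl hφ,
      h.weightedEvolutionNorm_le hp hσ φ⟩⟩
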